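/- Let $\mathfrak o$ be a compact discrete valuation ring with maximal ideal $\mathfrak m=\pi\mathfrak o$, let $q=\#(\mathfrak o/\mathfrak m)$ and $|x|=q^{-v(x)}$. Let $\emptyset\ne I=\{i_1<\dots<i_\ell\}\subseteq\{1,\dots,n-1\}$. For a commutative ring $R$, let $L_I(R)$ be the group of block lower triangular $n\times n$ matrices over $R$ with identity diagonal blocks of sizes $i_1,i_2-i_1,\dots,n-i_\ell$, and let $\mathcal R_I(R)$ be the set of $I$-reduced matrices: the $A\in \mathrm{GL}_n(R)$ such that the leftmost invertible entry of each row is $1$ (a leading $1$), all entries above a leading $1$ are $0$, and within each of the row blocks $i_j+1,\dots,i_{j+1}$ (with $i_0=0$, $i_{\ell+1}=n$) the leading $1$'s occur in strictly increasing column positions. For $E\in L_I(\mathfrak o/\mathfrak m)$ let $\tau_{I,E}$ be the number of $\sigma\in\mathbb S_n$ such that permuting the columns of $E$ by $\sigma$ gives an element of $\mathcal R_I(\mathfrak o/\mathfrak m)$. Let $\mu$ be the normalized Haar measure on $L_I(\mathfrak o)$, and write $\overline B$ for the reduction of $B$ modulo $\mathfrak m$. For $(r_0,\mathbf r)\in\mathbb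 N_0\times\mathbb N^I$ (with $\mathbb N=\{1,2,\dots\}$) let $D(I,\mathbf r)$ be the diagonal matrix with $i$-th entry $\prod_{\iota\in I,\ \iota\ge i}\pi^{r_\iota}$, and let $h_n(I,r_0,\mathbf r)$ be the number of finite-index $\mathfrak o$-submodules $\Lambda\le\mathfrak o^n$ that are closed under componentwise multiplication and are generated by the rows of $\pi^{r_0}D(I,\mathbf r)A$ for some $A\in\mathrm{GL}_n(\mathfrak o)$. Finally, for $x_0\in\mathfrak o$, $\mathbf x\in\mathfrak o^I$ and $B\in L_I(\mathfrak o)$, let $\mathrm{Div}(x_0,\mathbf x,B)$ be the condition $$\prod_{\iota\in I,\ j\le\iota<i}x_\iota\ \Big|\ x_0\Big(\prod_{\iota\in I,\ i'\le\iota}x_\iota\Big)\sum_{k=1}^{i}B_{ik}B_{i'k}(B^{-1})_{kj}\qquad\text{for all }1\le j<i\le i'\le n,$$ and put $\mathscr B_{I,r_0,\mathbf r}=\{B\in L_I(\mathfrak o):\mathrm{Div}(\pi^{r_0},(\pi^{r_\iota})_\iota,B)\}$ and $\mathscr M'_I=\{(x_0,\mathbf x,B)\in\mathfrak o\times\mathfrak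 m^I\times L_I(\mathfrak o):\mathrm{Div}(x_0,\mathbf x,B)\}$. (1) For all $(r_0,\mathbf r)\in\mathbb N_0\times\mathbb N^I$ the number $h_n(I,r_0,\mathbf r)$ is finite and $$h_n(I,r_0,\mathbf r)=q^{\sum_{\iota\in I}r_\iota\,\iota(n-\iota)}\sum_{E\in L_I(\mathfrak o/\mathfrak m)}\tau_{I,E}\;\mu\big(\{B\in\mathscr B_{I,r_0,\mathbf r}:\overline B=E\}\big).$$ (2) Let $s_0\in\mathbb C$ and $(s_\iota)_{\iota\in I}\in\mathbb C^I$. The series $$\Xi_{n,I}(s_0,(s_\iota)_{\iota\in I})=\sum_{(r_0,\mathbf r)\in\mathbb N_0\times\mathbb N^I}q^{-s_0nr_0-\sum_{\iota\in I}r_\iota\,\iota\,s_\iota}\,h_n(I,r_0,\mathbf r)$$ converges absolutely if and only if all of the integrals below, for $E\in L_I(\mathfrak o/\mathfrak m)$, converge absolutely, and in that case $$\Xi_{n,I}(s_0,(s_\iota)_{\iota\in I})=\frac1{(1-q^{-1})^{\#I+1}}\sum_{E\in L_I(\mathfrak o/\mathfrak m)}\tau_{I,E}\int_{(x_0,\mathbf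 x,B)\in\mathscr M'_I,\ \overline B=E}|x_0|^{s_0n-1}\prod_{\iota\in I}|x_\iota|^{\iota(s_\iota-(n-\iota))-1}\,|d\mathbf x|\,|dB|,$$ where $|d\mathbf x|\,|dB|$ is the product of the normalized Haar measures on $\mathfrak o\times\mathfrak o^I\times L_I(\mathfrak o)$. -/

import Mathlib

open MeasureTheory TopologicalSpace

namespace OSubalg

/-! ### Block structure attached to a set `I ⊆ {1, …, n-1}`

Rows and columns are indexed by `Fin n`, so the `i`-th row of the usual `1`-based numbering is
the row of index `i - 1`.  The elements of `I` themselves are never shifted.  Hence the `1`-based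
condition `j ≤ ι < i` reads `j < ι ∧ ι ≤ i` here, and the `1`-based `i ≤ ι` reads `i < ι`. -/

/-- The position `(i, j)` lies strictly below the diagonal blocks determined by `I`. -/
def Below {n : ℕ} (I : Finset ℕ) (i j : Fin n) : Prop :=
  ∃ ι ∈ I, (j : ℕ) < ι ∧ ι ≤ (i : ℕ)

/-- Two indices lie in the same block of `I`. -/
def SameBlock {n : ℕ} (I : Finset ℕ) (i j : Fin n) : Prop :=
  ¬ Below I i j ∧ ¬ Below I j i

/-- The group `L_I(R)` of block lower triangular matrices with identity diagonal blocks
(a determinant of such a matrix is automatically `1`). -/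
def LI (n : ℕ) (I : Finset ℕ) (R : Type*) [CommRing R] :
    Subgroup (Matrix.SpecialLinearGroup (Fin n) R) where
  carrier := {B | ∀ i j, ¬ Below I i j → B.1 i j = (1 : Matrix (Fin n) (Fin n) R) i j}
  one_mem' := fun i j _ => rfl
  mul_mem' := by
    intro A B hA hB i j hij
    change (A.1 * B.1) i j = _
    rw [Matrix.mul_apply]
    have h : ∀ k, A.1 i k * B.1 k j =
        (1 : Matrix (Fin n) (Fin n) R) i k * (1 : Matrix (Fin n) (Fin n) R) k j := by
      intro k
      by_cases h1 : Below I i k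
      · have h2 : ¬ Below I k j := by
          rintro ⟨ι, hι, h3, h4⟩
          obtain ⟨κ, hκ, h5, h6⟩ := h1
          exact hij ⟨ι, hι, h3, by omega⟩
        rw [hB k j h2]
        by_cases hkj : k = j
        · subst hkj; exact absurd h1 hij
        · rw [Matrix.one_apply_ne hkj]; simp
      · rw [hA i k h1]
        by_cases hik : i = k
        · subst hik; rw [hB i j hij]
        · rw [Matrix.one_apply_ne hik]; simp
    rw [Finset.sum_congr rfl (fun k _ => h k), ← Matrix.mul_apply, Matrix.one_mul]
  inv_mem' := by
    intro B hB
    have hmul : (B⁻¹).1 * B.1 = 1 := by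
      exact congrArg Subtype.val (inv_mul_cancel B)
    have key : ∀ m : ℕ, ∀ i j : Fin n, n - (j : ℕ) ≤ m → ¬ Below I i j →
        (B⁻¹).1 i j = (1 : Matrix (Fin n) (Fin n) R) i j := by
      intro m
      induction m with
      | zero => intro i j h; have := j.2; omega
      | succ m ih =>
        intro i j h hij
        have e := congrFun (congrFun hmul i) j
        rw [Matrix.mul_apply, Finset.sum_eq_single j] at e
        · rw [hB j j (by rintro ⟨ι, _, h1, h2⟩; omega), Matrix.one_apply_eq, mul_one] at e
          exact e
        · intro k _ hkj
          by_cases hb : Below I k j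
          · have hik : ¬ Below I i k := by
              rintro ⟨ι, hι, h1, h2⟩
              obtain ⟨κ, hκ, h3, h4⟩ := hb
              exact hij ⟨ι, hι, by omega, h2⟩
            have hjk : (j : ℕ) < k := by
              obtain ⟨κ, hκ, h3, h4⟩ := hb; omega
            have hk := k.2
            rw [ih i k (by omega) hik]
            by_cases h' : i = k
            · subst h'; exact absurd hb hij
            · rw [Matrix.one_apply_ne h', zero_mul]
          · rw [hB k j hb, Matrix.one_apply_ne hkj, mul_zero]
        · intro h'; exact absurd (Finset.mem_univ j) h'
    intro i j hij
    exact key _ i j le_rfl hij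

/-- The underlying matrix of an element of `L_I(R)`. -/
def toMat {n : ℕ} {I : Finset ℕ} {R : Type*} [CommRing R] (B : LI n I R) :
    Matrix (Fin n) (Fin n) R := B.1.1

/-! ### Reduced matrices and the numbers `τ` -/

/-- `I`-reduced invertible matrices: `c i` is the column of the leftmost invertible entry of row
`i`, this entry is `1`, all entries above it are zero, and within each block of rows the columns
of these leading ones are strictly increasing. -/
def IsReduced {n : ℕ} (I : Finset ℕ) {R : Type*} [CommRing R]
    (A : Matrix (Fin n) (Fin n) R) : Prop :=
  IsUnit A ∧ ∃ c : Fin n → Fin n,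
    (∀ i, A i (c i) = 1 ∧ ∀ j < c i, ¬ IsUnit (A i j)) ∧
    (∀ i i', i' < i → A i' (c i) = 0) ∧
    (∀ i i', i < i' → SameBlock I i i' → c i < c i')

/-- `τ_{I,E}`: the number of permutations of the columns of `E` that make `E` `I`-reduced. -/
noncomputable def tau {n : ℕ} (I : Finset ℕ) {R : Type*} [CommRing R] (E : LI n I R) : ℕ :=
  Nat.card {σ : Equiv.Perm (Fin n) // IsReduced I ((toMat E).submatrix id σ)}

/-! ### Submodules of a given elementary divisor type -/

/-- The diagonal matrix `D(I, r)`; in `1`-based numbering its `i`-th diagonal entry is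
`∏_{ι ∈ I, i ≤ ι} π ^ r_ι`. -/
def diagMat (n : ℕ) (I : Finset ℕ) {R : Type*} [CommRing R] (π : R) (r : I → ℕ+) :
    Matrix (Fin n) (Fin n) R :=
  Matrix.diagonal fun i => ∏ ι ∈ Finset.univ.filter (fun ι : I => (i : ℕ) < (ι : ℕ)), π ^ (r ι : ℕ)

/-- `Λ` has elementary divisor type `(I, r₀, r)`: it is generated by the rows of
`π ^ r₀ D(I, r) A` for some `A ∈ GL_n(R)`. -/
def HasType {n : ℕ} {R : Type*} [CommRing R] (π : R) (I : Finset ℕ) (r₀ : ℕ) (r : I → ℕ+)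
    (Λ : Submodule R (Fin n → R)) : Prop :=
  ∃ A : Matrix.GeneralLinearGroup (Fin n) R,
    Λ = Submodule.span R (Set.range (π ^ r₀ • (diagMat n I π r * A.1)).row)

/-- The finite-index subalgebras of `R ^ n` (submodules closed under componentwise
multiplication, not necessarily containing `1`) of type `(I, r₀, r)`. -/
def subalgebrasOfType (n : ℕ) {R : Type*} [CommRing R] (π : R) (I : Finset ℕ) (r₀ : ℕ)
    (r : I → ℕ+) : Set (Submodule R (Fin n → R)) :=
  {Λ | Finite ((Fin n → R) ⧸ Λ) ∧ (∀ x ∈ Λ, ∀ y ∈ Λ, x * y ∈ Λ) ∧ HasType π I r₀ r Λ}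

/-- `h_n(I, r₀, r)`. -/
noncomputable def hNum (n : ℕ) {R : Type*} [CommRing R] (π : R) (I : Finset ℕ) (r₀ : ℕ)
    (r : I → ℕ+) : ℕ :=
  (subalgebrasOfType n π I r₀ r).ncard

/-! ### The divisibility conditions -/

/-- In `1`-based numbering: for all `j < i ≤ i'`, the product of the `x_ι` with `j ≤ ι < i`
divides `x₀ (∏_{i' ≤ ι} x_ι) (∑_{k ≤ i} B_{ik} B_{i'k} (B⁻¹)_{kj})`. -/
def DivCond {n : ℕ} {I : Finset ℕ} {R : Type*} [CommRing R] (x₀ : R) (x : I → R)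
    (B : LI n I R) : Prop :=
  ∀ j i i' : Fin n, j < i → i ≤ i' →
    (∏ ι ∈ Finset.univ.filter (fun ι : I => (j : ℕ) < (ι : ℕ) ∧ (ι : ℕ) ≤ (i : ℕ)), x ι) ∣
      x₀ * (∏ ι ∈ Finset.univ.filter (fun ι : I => (i' : ℕ) < (ι : ℕ)), x ι) *
        ∑ k ∈ Finset.Iic i, toMat B i k * toMat B i' k * toMat B⁻¹ k j

/-- The set `ℬ_{I,r₀,r} ⊆ L_I(R)`. -/
def setB (n : ℕ) {I : Finset ℕ} {R : Type*} [CommRing R] (π : R) (r₀ : ℕ) (r : I → ℕ+) :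
    Set (LI n I R) :=
  {B | DivCond (π ^ r₀) (fun ι => π ^ (r ι : ℕ)) B}

section Local

variable {O : Type*} [CommRing O] [IsLocalRing O]

/-- The set of `B ∈ L_I(O)` whose reduction modulo the maximal ideal is `E`. -/
def fiber {n : ℕ} {I : Finset ℕ} (E : LI n I (IsLocalRing.ResidueField O)) :
    Set (LI n I O) :=
  {B | (toMat B).map (IsLocalRing.residue O) = toMat E}

/-- The set `ℳ'_I ⊆ O × 𝔪^I × L_I(O)`. -/
def setM (n : ℕ) (I : Finset ℕ) (O : Type*) [CommRing O] [IsLocalRing O] :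
    Set (O × (I → O) × LI n I O) :=
  {p | (∀ ι, p.2.1 ι ∈ IsLocalRing.maximalIdeal O) ∧ DivCond p.1 p.2.1 p.2.2}

/-- The cardinality of the residue field. -/
noncomputable def resCard (O : Type*) [CommRing O] [IsLocalRing O] : ℕ :=
  Nat.card (IsLocalRing.ResidueField O)

end Local

/-- The absolute value `|x| = q ^ (-v(x))` on a discrete valuation ring, with `|0| = 0`. -/
noncomputable def dvrAbs {O : Type*} [CommRing O] [IsDomain O] [IsDiscreteValuationRing O]
    (x : O) : ℝ :=
  open Classical in
  if x = 0 then 0 else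
    ((resCard O : ℝ)⁻¹) ^ (IsDiscreteValuationRing.addVal O x).toNat

/-! ### Topology and Haar measure -/

section Top

variable {n : ℕ} {I : Finset ℕ} {O : Type*} [CommRing O] [TopologicalSpace O]
  [IsTopologicalRing O]

instance instCompactSpaceLI [CompactSpace O] [T2Space O] : CompactSpace (LI n I O) := by
  have : CompactSpace (Matrix (Fin n) (Fin n) O) :=
    inferInstanceAs (CompactSpace (Fin n → Fin n → O))
  have hS : IsClosed {M : Matrix (Fin n) (Fin n) O | M.det = 1} :=
    isClosed_eq (Continuous.matrix_det continuous_id) continuous_const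
  have : CompactSpace (Matrix.SpecialLinearGroup (Fin n) O) :=
    isCompact_iff_compactSpace.1 hS.isCompact
  have hL : IsClosed ((LI n I O : Subgroup (Matrix.SpecialLinearGroup (Fin n) O)) :
      Set (Matrix.SpecialLinearGroup (Fin n) O)) := by
    have : ((LI n I O : Subgroup (Matrix.SpecialLinearGroup (Fin n) O)) :
        Set (Matrix.SpecialLinearGroup (Fin n) O)) =
        ⋂ i, ⋂ j, ⋂ _ : ¬ Below I i j,
          {B | B.1 i j = (1 : Matrix (Fin n) (Fin n) O) i j} := by
      ext B
      simp only [Set.mem_iInter]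
      rfl
    rw [this]
    refine isClosed_iInter fun i => isClosed_iInter fun j => isClosed_iInter fun _ => ?_
    refine isClosed_eq ?_ continuous_const
    exact (continuous_apply j).comp ((continuous_apply i).comp continuous_subtype_val)
  exact isCompact_iff_compactSpace.1 hL.isCompact

instance instMeasurableSpaceLI : MeasurableSpace (LI n I O) := borel _

instance instBorelSpaceLI : BorelSpace (LI n I O) := ⟨rfl⟩

/-- The normalized Haar measure on the compact group `L_I(O)`. -/
noncomputable def haarLI (n : ℕ) (I : Finset ℕ) (O : Type*) [CommRing O] [TopologicalSpace O]
    [IsTopologicalRing O] [CompactSpace O] [T2Space O] : Measure (LI n I O) :=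
  Measure.haarMeasure (⊤ : PositiveCompacts (LI n I O))

/-- The normalized Haar measure on `(O, +)`. -/
noncomputable def haarO (O : Type*) [CommRing O] [TopologicalSpace O] [IsTopologicalRing O]
    [CompactSpace O] [MeasurableSpace O] [BorelSpace O] : Measure O :=
  Measure.addHaarMeasure (⊤ : PositiveCompacts O)

end Top

/-- The product of the normalized Haar measures on `O × O^I × L_I(O)`. -/
noncomputable def haarProd (n : ℕ) (I : Finset ℕ) (O : Type*) [CommRing O] [TopologicalSpace O]
    [IsTopologicalRing O] [CompactSpace O] [T2Space O] [MeasurableSpace O] [BorelSpace O] :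
    Measure (O × (I → O) × LI n I O) :=
  (haarO O).prod ((Measure.pi fun _ : I => haarO O).prod (haarLI n I O))

noncomputable instance instFintypeLI {n : ℕ} {I : Finset ℕ} {k : Type*} [CommRing k] [Finite k] :
    Fintype (LI n I k) :=
  have : Finite (Matrix (Fin n) (Fin n) k) := inferInstanceAs (Finite (Fin n → Fin n → k))
  have : Finite (Matrix.SpecialLinearGroup (Fin n) k) :=
    Finite.of_injective (fun B => B.1) Subtype.val_injective
  Fintype.ofFinite _

/-! ### The series `Ξ_{n,I}` and the integrand of its integral representation -/

section Xi

variable {O : Type*} [CommRing O] [IsDomain O] [IsDiscreteValuationRing O]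

/-- The term of index `(r₀, r)` of the series `Ξ_{n,I}(s₀, s)`. -/
noncomputable def xiTerm (n : ℕ) (I : Finset ℕ) (π : O) (s₀ : ℂ) (s : I → ℂ)
    (p : ℕ × (I → ℕ+)) : ℂ :=
  (resCard O : ℂ) ^ (-(s₀ * n * p.1) - ∑ ι : I, ((p.2 ι : ℕ) : ℂ) * ((ι : ℕ) : ℂ) * s ι) *
    (hNum n π I p.1 p.2 : ℂ)

/-- The generating series `Ξ_{n,I}(s₀, s)`. -/
noncomputable def Xi (n : ℕ) (I : Finset ℕ) (π : O) (s₀ : ℂ) (s : I → ℂ) : ℂ :=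
  ∑' p : ℕ × (I → ℕ+), xiTerm n I π s₀ s p

/-- `|x₀| ^ (s₀ n - 1) ∏_{ι ∈ I} |x_ι| ^ (ι (s_ι - (n - ι)) - 1)`. -/
noncomputable def xiIntegrand (n : ℕ) (I : Finset ℕ) (s₀ : ℂ) (s : I → ℂ)
    (p : O × (I → O) × LI n I O) : ℂ :=
  (dvrAbs p.1 : ℂ) ^ (s₀ * n - 1) *
    ∏ ι : I, (dvrAbs (p.2.1 ι) : ℂ) ^
      (((ι : ℕ) : ℂ) * (s ι - ((n : ℂ) - ((ι : ℕ) : ℂ))) - 1)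

end Xi

end OSubalg

/-! Write D for D(I, r). The rows of π^r₀ D A and of π^r₀ D A' span the same lattice exactly when A
= g A' with D g D⁻¹ invertible over O, that is, when each entry g_ij is divisible by the product of
the π^r_ι over the ι ∈ I that separate j from i. Since all r_ι are positive, such a g is block upper
triangular modulo 𝔪. Row reduction brings A to the form B P_σ with B ∈ L_I(O) and I-reduced
reduction (`exists_reduced`). The permutation σ is an invariant of the lattice: block upper
triangular matrices preserve the spans of the bottom rows modulo 𝔪, and the leading columns of these
spans recover σ (`IsReduced.perm_unique`). For fixed σ, B is unique up to left multiplication by the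
group H of weighted matrices (`wtSubgroup`). As H is trivial modulo 𝔪, the reduction E of B is an
invariant too. So the lattices of a given type correspond to triples (E, σ, HB), with τ_E choices of
σ for each E.

Componentwise multiplication commutes with permutations of the columns, so closure under it does not
involve σ; expanding products of rows in the lattice basis turns closure into Div
(`lat_mul_closed_iff`). The admissible B above E thus form a union of cosets HB. Counting modulo a
large power of π gives the index of H (`index_wtSubgroup`), and each coset has Haar measure 1/index.
This proves (1).

For (2), the part of ℳ'_I above E is, up to a null set, the disjoint union of cells on which all
valuations are fixed. On a cell the integrand is constant, and the measure of the cell is a product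
of sphere measures and a measure from (1). Hence the integral over E is, up to the factor (1 -
q⁻¹)^(#I+1), the part of the series that belongs to E. In each term of Ξ the contributions of the
various E are nonnegative multiples of one complex number, and τ_E ≥ 1 (`tau_pos`), so they cannot
cancel: the series converges absolutely if and only if all the integrals do. -/

namespace OSubalg

/-! ### Leading columns of a matrix over a field -/

section LeadCols

variable {n : ℕ} {k : Type*} [Field k]

open Classical in
/-- The positions of the leading entries of the vectors in the row space of `M`. -/
noncomputable def leadCols {T : Type*} [Fintype T] (M : Matrix T (Fin n) k) : Finset (Fin n) :=
  Finset.univ.filter fun j => ∃ w : T → k,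
    Matrix.vecMul w M j ≠ 0 ∧ ∀ j' < j, Matrix.vecMul w M j' = 0

theorem mem_leadCols {T : Type*} [Fintype T] {M : Matrix T (Fin n) k} {j : Fin n} :
    j ∈ leadCols M ↔ ∃ w : T → k,
      Matrix.vecMul w M j ≠ 0 ∧ ∀ j' < j, Matrix.vecMul w M j' = 0 := by
  simp [leadCols]

theorem exists_lead {x : Fin n → k} (hx : x ≠ 0) : ∃ j, x j ≠ 0 ∧ ∀ j' < j, x j' = 0 := by
  classical
  have hne : (Finset.univ.filter fun j => x j ≠ 0).Nonempty := by
    by_contra h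
    rw [Finset.not_nonempty_iff_eq_empty, Finset.filter_eq_empty_iff] at h
    exact hx (funext fun j => by simpa using h (Finset.mem_univ j))
  refine ⟨_, (Finset.mem_filter.1 (Finset.min'_mem _ hne)).2, fun j' hj' => ?_⟩
  by_contra h
  exact absurd (Finset.min'_le _ j' (Finset.mem_filter.2 ⟨Finset.mem_univ _, h⟩)) (not_le.2 hj')

variable {T : Type*} [Fintype T] {M : Matrix T (Fin n) k}

/-- Restriction of the row space to the leading columns. -/
noncomputable def leadRestrict (M : Matrix T (Fin n) k) : (T → k) →ₗ[k] (leadCols M → k) where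
  toFun w := fun j => Matrix.vecMul w M j
  map_add' v w := by ext; simp [Matrix.add_vecMul]
  map_smul' c w := by ext; simp [Matrix.smul_vecMul]

/-- A nonzero vector of the row space has its leading entry in a leading column, so it survives the
restriction. -/
theorem leadRestrict_injective (hM : Function.Injective fun w => Matrix.vecMul w M) :
    Function.Injective (leadRestrict M) := by
  rw [injective_iff_map_eq_zero]
  intro w hw
  by_contra hne
  have hx : Matrix.vecMul w M ≠ 0 := fun h => hne (hM (by simpa using h))
  obtain ⟨j, hj, hj'⟩ := exists_lead hx
  exact hj (congrFun hw ⟨j, mem_leadCols.2 ⟨w, hj, hj'⟩⟩)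

/-- Vectors chosen with leading entry in each of the leading columns restrict to a triangular square
matrix with nonzero diagonal, which is invertible. -/
theorem leadRestrict_surjective : Function.Surjective (leadRestrict M) := by
  classical
  choose v hv using fun j : leadCols M => mem_leadCols.1 j.2
  let N : Matrix (leadCols M) (leadCols M) k := fun j j' => Matrix.vecMul (v j) M j'
  have hdet : N.det ≠ 0 := by
    rw [Matrix.det_of_isUpperTriangular]
    · exact Finset.prod_ne_zero_iff.2 fun j _ => (hv j).1
    · intro j j' hj
      exact (hv j).2 _ hj
  intro y
  have hN : IsUnit N.det := isUnit_iff_ne_zero.2 hdet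
  refine ⟨∑ j, Matrix.vecMul y N⁻¹ j • v j, ?_⟩
  rw [map_sum]
  have : ∀ j, leadRestrict M (Matrix.vecMul y N⁻¹ j • v j) = Matrix.vecMul y N⁻¹ j • N j := by
    intro j; rw [map_smul]; rfl
  rw [Finset.sum_congr rfl fun j _ => this j, ← Matrix.vecMul_eq_sum, Matrix.vecMul_vecMul,
    Matrix.nonsing_inv_mul _ hN, Matrix.vecMul_one]

theorem card_leadCols (hM : Function.Injective fun w => Matrix.vecMul w M) :
    (leadCols M).card = Fintype.card T := by
  have := (LinearEquiv.ofBijective (leadRestrict M)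
    ⟨leadRestrict_injective hM, leadRestrict_surjective⟩).finrank_eq
  simpa using this.symm

end LeadCols

/-! ### The pivot permutation of an invertible matrix -/

section Pivots

variable {n : ℕ} {k : Type*} [Field k]

/-- Leading columns of the span of the rows of index `≥ t`. -/
noncomputable def piv (A : Matrix (Fin n) (Fin n) k) (t : ℕ) : Finset (Fin n) :=
  leadCols (A.submatrix (Subtype.val : {i : Fin n // t ≤ (i : ℕ)} → Fin n) id)

/-- Extension by zero of a vector indexed by the indices `≥ t`. -/
def extendZero {R : Type*} [Zero R] (t : ℕ) (w : {i : Fin n // t ≤ (i : ℕ)} → R) : Fin n → R :=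
  fun i => if h : t ≤ (i : ℕ) then w ⟨i, h⟩ else 0

theorem extendZero_vecMul {R m : Type*} [CommRing R] (t : ℕ)
    (w : {i : Fin n // t ≤ (i : ℕ)} → R) (A : Matrix (Fin n) m R) :
    Matrix.vecMul (extendZero t w) A = Matrix.vecMul w (A.submatrix Subtype.val id) := by
  ext j
  simp only [Matrix.vecMul, dotProduct, extendZero, Matrix.submatrix_apply, id]
  rw [← Finset.sum_filter_add_sum_filter_not Finset.univ (fun i : Fin n => t ≤ (i : ℕ))]
  rw [Finset.sum_eq_zero (s := Finset.univ.filter fun i : Fin n => ¬ t ≤ (i : ℕ)), add_zero,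
    ← Finset.sum_subtype_of_mem (p := fun i : Fin n => t ≤ (i : ℕ))
      (s := Finset.univ.filter fun i : Fin n => t ≤ (i : ℕ)) _ (fun i hi => by simpa using hi)]
  · refine Finset.sum_congr (by ext x; simpa using x.2) fun i _ => ?_
    rw [dif_pos i.2]
  · intro i hi
    rw [dif_neg (Finset.mem_filter.1 hi).2, zero_mul]

theorem mem_piv {A : Matrix (Fin n) (Fin n) k} {t : ℕ} {j : Fin n} :
    j ∈ piv A t ↔ ∃ v : Fin n → k, (∀ i : Fin n, (i : ℕ) < t → v i = 0) ∧
      Matrix.vecMul v A j ≠ 0 ∧ ∀ j' < j, Matrix.vecMul v A j' = 0 := by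
  rw [piv, mem_leadCols]
  constructor
  · rintro ⟨w, hw⟩
    refine ⟨extendZero t w, fun i hi => dif_neg (not_le.2 hi), ?_⟩
    rwa [extendZero_vecMul]
  · rintro ⟨v, hv, hw⟩
    refine ⟨fun i => v i, ?_⟩
    rw [← extendZero_vecMul]
    have : extendZero t (fun i : {i : Fin n // t ≤ (i : ℕ)} => v i) = v := by
      ext i
      by_cases h : t ≤ (i : ℕ)
      · exact dif_pos h
      · rw [hv i (not_le.1 h)]; exact dif_neg h
    rwa [this]

theorem piv_antitone (A : Matrix (Fin n) (Fin n) k) : Antitone (piv A) := by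
  intro t t' h j
  simp only [mem_piv]
  rintro ⟨v, hv, h'⟩
  exact ⟨v, fun i hi => hv i (by omega), h'⟩

theorem vecMul_botRows_injective {A : Matrix (Fin n) (Fin n) k} (hA : IsUnit A) (t : ℕ) :
    Function.Injective fun w => Matrix.vecMul w
      (A.submatrix (Subtype.val : {i : Fin n // t ≤ (i : ℕ)} → Fin n) id) := by
  intro w w' h
  simp only [← extendZero_vecMul] at h
  have := Matrix.vecMul_injective_of_isUnit hA h
  ext i
  have := congrFun this i
  rwa [extendZero, extendZero, dif_pos i.2, dif_pos i.2] at this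

theorem card_le_val (t : ℕ) :
    (Finset.univ.filter fun i : Fin n => t ≤ (i : ℕ)).card = n - t := by
  have h := Fin.card_filter_val_lt (n := n) (m := t)
  have h2 := Finset.card_filter_add_card_filter_not (s := (Finset.univ : Finset (Fin n)))
    (fun i : Fin n => (i : ℕ) < t)
  simp only [not_lt, Finset.card_univ, Fintype.card_fin] at h2
  omega

theorem card_piv {A : Matrix (Fin n) (Fin n) k} (hA : IsUnit A) (t : ℕ) :
    (piv A t).card = n - t := by
  rw [piv, card_leadCols (vecMul_botRows_injective hA t), Fintype.card_subtype, card_le_val]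

/-- The number of `t ∈ I` with `j ∈ piv A t`. -/
noncomputable def blockLabel (I : Finset ℕ) (A : Matrix (Fin n) (Fin n) k) (j : Fin n) : ℕ :=
  (I.filter fun t => j ∈ piv A t).card

/-- The columns of the leading ones of the reduced matrix attached to `A`. -/
noncomputable def pivPerm (I : Finset ℕ) (A : Matrix (Fin n) (Fin n) k) : Equiv.Perm (Fin n) :=
  Tuple.sort (blockLabel I A)

/-- As `piv A` is antitone, the t ∈ I with j ∈ `piv A t` form an initial segment of I, which is
determined by its cardinality. -/
theorem mem_piv_iff_le_blockLabel {I : Finset ℕ} {A : Matrix (Fin n) (Fin n) k} {t : ℕ}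
    (ht : t ∈ I) {j : Fin n} :
    j ∈ piv A t ↔ (I.filter fun t' => t' ≤ t).card ≤ blockLabel I A j := by
  constructor
  · intro h
    refine Finset.card_le_card fun t' ht' => ?_
    rw [Finset.mem_filter] at ht' ⊢
    exact ⟨ht'.1, piv_antitone A ht'.2 h⟩
  · intro h
    by_contra hj
    refine absurd h (not_le.2 (Finset.card_lt_card ?_))
    rw [Finset.ssubset_iff_of_subset]
    · exact ⟨t, by simp [ht], by simp [hj]⟩
    · intro t' ht'
      rw [Finset.mem_filter] at ht' ⊢
      refine ⟨ht'.1, ?_⟩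
      by_contra hlt
      exact hj (piv_antitone A (le_of_not_ge hlt) ht'.2)

theorem upper_eq_of_card {U : Finset (Fin n)} {t : ℕ} (ht : t ≤ n)
    (hU : ∀ i ∈ U, ∀ i', i ≤ i' → i' ∈ U) (hc : U.card = n - t) (i : Fin n) :
    i ∈ U ↔ t ≤ (i : ℕ) := by
  have hsub : U ⊆ Finset.univ.filter fun i : Fin n => t ≤ (i : ℕ) := by
    intro i hi
    have h1 : Finset.Ici i ⊆ U := fun i' hi' => hU i hi i' (Finset.mem_Ici.1 hi')
    have h2 := Finset.card_le_card h1
    rw [Fin.card_Ici] at h2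
    simp only [Finset.mem_filter, Finset.mem_univ, true_and]
    have := i.2
    omega
  rw [Finset.eq_of_subset_of_card_le hsub (by rw [card_le_val, hc])]
  simp

/-- Sorting by the labels turns `piv A t` into an upper set of indices, and its cardinality n - t
leaves only one possibility. The value t = 0 is allowed because the first block starts there
although 0 need not be in I. -/
theorem pivPerm_mem_piv {I : Finset ℕ} (hI : ∀ t ∈ I, t ≤ n) {A : Matrix (Fin n) (Fin n) k}
    (hA : IsUnit A) {t : ℕ} (ht : t ∈ I ∨ t = 0) (i : Fin n) :
    pivPerm I A i ∈ piv A t ↔ t ≤ (i : ℕ) := by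
  rcases ht with ht | rfl
  · have := upper_eq_of_card (U := (piv A t).map (pivPerm I A).symm.toEmbedding) (hI t ht) ?_
      (by rw [Finset.card_map, card_piv hA]) i
    · rw [← this]; simp
    · intro i hi i' hii'
      simp only [Finset.mem_map_equiv, Equiv.symm_symm] at hi ⊢
      rw [mem_piv_iff_le_blockLabel ht] at hi ⊢
      exact hi.trans (Tuple.monotone_sort (blockLabel I A) hii')
  · have : piv A 0 = Finset.univ := by
      rw [← Finset.card_eq_iff_eq_univ, card_piv hA]; simp
    simp [this]

/-- Multiplying by a block upper triangular matrix does not enlarge the row spaces. -/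
theorem piv_mul_subset {I : Finset ℕ} {q A : Matrix (Fin n) (Fin n) k}
    (hq : ∀ i j, Below I i j → q i j = 0) {t : ℕ} (ht : t ∈ I) : piv (q * A) t ⊆ piv A t := by
  intro j
  simp only [mem_piv]
  rintro ⟨v, hv, h⟩
  rw [← Matrix.vecMul_vecMul] at h
  refine ⟨Matrix.vecMul v q, fun i hi => ?_, h⟩
  rw [Matrix.vecMul, dotProduct]
  refine Finset.sum_eq_zero fun l _ => ?_
  by_cases hl : (l : ℕ) < t
  · rw [hv l hl, zero_mul]
  · rw [hq l i ⟨t, ht, hi, by omega⟩, mul_zero]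

theorem pivPerm_congr {I : Finset ℕ} {A A' : Matrix (Fin n) (Fin n) k}
    (h : ∀ t ∈ I, piv A t = piv A' t) : pivPerm I A = pivPerm I A' := by
  unfold pivPerm
  congr 1
  ext j
  unfold blockLabel
  congr 1
  exact Finset.filter_congr fun t ht => by rw [h t ht]

theorem toMat_lower {I : Finset ℕ} {R : Type*} [CommRing R] (E : LI n I R) {i j : Fin n}
    (h : ¬ Below I i j) : toMat E i j = (1 : Matrix (Fin n) (Fin n) R) i j := E.2 i j h

theorem not_below_of_le {I : Finset ℕ} {i j : Fin n} (h : i ≤ j) : ¬ Below I i j := by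
  rintro ⟨ι, _, h1, h2⟩
  have : (i : ℕ) ≤ j := h
  omega

theorem toMat_diag {I : Finset ℕ} {R : Type*} [CommRing R] (E : LI n I R) (i : Fin n) :
    toMat E i i = 1 := by
  rw [toMat_lower E (not_below_of_le le_rfl), Matrix.one_apply_eq]

theorem toMat_of_lt {I : Finset ℕ} {R : Type*} [CommRing R] (E : LI n I R) {i j : Fin n}
    (h : i < j) : toMat E i j = 0 := by
  rw [toMat_lower E (not_below_of_le h.le), Matrix.one_apply_ne h.ne]

/-- The leading ones of a reduced matrix `E P_σ` are in the columns given by `σ⁻¹`. -/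
theorem IsReduced.lead {I : Finset ℕ} {E : LI n I k} {σ : Equiv.Perm (Fin n)}
    (h : IsReduced I ((toMat E).submatrix id σ)) :
    (∀ i, ∀ j < σ.symm i, toMat E i (σ j) = 0) ∧
      ∀ i i', i < i' → SameBlock I i i' → σ.symm i < σ.symm i' := by
  obtain ⟨-, c, h1, h2, h3⟩ := h
  have hc : ∀ i, c i = σ.symm i := by
    intro i
    rw [Equiv.eq_symm_apply]
    -- The column `c i` of E P_σ is the column `σ (c i)` of E. If `σ (c i) < i`, the diagonal 1 of E
    -- lies above the leading one, which is forbidden; if `σ (c i) > i`, the entry vanishes by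
    -- triangularity.
    rcases lt_trichotomy (σ (c i)) i with h | h | h
    · have := h2 i _ h
      simp [toMat_diag] at this
    · exact h
    · have := (h1 i).1
      simp [toMat_of_lt E h] at this
  simp only [hc] at h1 h3
  exact ⟨fun i j hj => by simpa [isUnit_iff_ne_zero] using (h1 i).2 j hj, h3⟩

theorem sameBlock_of_forall {I : Finset ℕ} {i i' : Fin n} (hlt : i < i')
    (h : ∀ t ∈ I, t ≤ (i' : ℕ) → t ≤ (i : ℕ)) : SameBlock I i i' := by
  refine ⟨not_below_of_le hlt.le, ?_⟩
  rintro ⟨t, ht, h1, h2⟩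
  have := h t ht h2
  omega

theorem isUnit_toMat {I : Finset ℕ} {R : Type*} [CommRing R] (E : LI n I R) :
    IsUnit (toMat E) := by
  rw [Matrix.isUnit_iff_isUnit_det]
  exact E.1.2 ▸ isUnit_one

theorem isUnit_submatrix_perm {R : Type*} [CommRing R] {A : Matrix (Fin n) (Fin n) R}
    (hA : IsUnit A) (σ : Equiv.Perm (Fin n)) : IsUnit (A.submatrix id σ) := by
  have := (Matrix.isUnit_submatrix_equiv (A := A) (Equiv.refl _) σ).2 hA
  simpa using this

/-- The leading ones of the rows of index ≥ t give n - t leading columns of their span, hence all of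
them. So the label of the column σ⁻¹(i) counts the t ∈ I with t ≤ i: it is monotone in i and
constant exactly on blocks, where σ⁻¹ increases. This characterizes the stable sort. -/
theorem IsReduced.symm_eq_pivPerm {I : Finset ℕ} {E : LI n I k} {σ : Equiv.Perm (Fin n)} (h : IsReduced I ((toMat E).submatrix id σ)) :
    σ.symm = pivPerm I ((toMat E).submatrix id σ) := by
  obtain ⟨h1, h2⟩ := h.lead
  set X := (toMat E).submatrix id σ with hX
  have hu : IsUnit X := isUnit_submatrix_perm (isUnit_toMat E) σ
  have hmem : ∀ t ∈ I, ∀ i, σ.symm i ∈ piv X t ↔ t ≤ (i : ℕ) := by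
    intro t ht i
    have hsub : (Finset.univ.filter fun i : Fin n => t ≤ (i : ℕ)).map σ.symm.toEmbedding ⊆
        piv X t := by
      intro j hj
      obtain ⟨i, hi, rfl⟩ := Finset.mem_map.1 hj
      rw [mem_piv]
      refine ⟨Pi.single i 1, fun l hl => Pi.single_eq_of_ne ?_ _, ?_, ?_⟩
      · rintro rfl
        simp at hi
        omega
      · simp [hX, toMat_diag]
      · intro j' hj'
        simpa [hX] using h1 i j' hj'
    have := Finset.eq_of_subset_of_card_le hsub (by
      rw [Finset.card_map, card_le_val, card_piv hu])
    rw [← this]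
    simp
  have hlab : ∀ i, blockLabel I X (σ.symm i) = (I.filter fun t => t ≤ (i : ℕ)).card := by
    intro i
    unfold blockLabel
    congr 1
    exact Finset.filter_congr fun t ht => hmem t ht i
  rw [pivPerm, Tuple.eq_sort_iff]
  constructor
  · intro i i' hii'
    simp only [Function.comp_apply, hlab]
    refine Finset.card_le_card fun t ht => ?_
    rw [Finset.mem_filter] at ht ⊢
    exact ⟨ht.1, ht.2.trans hii'⟩
  · intro i i' hlt heq
    rw [hlab, hlab] at heq
    refine h2 i i' hlt (sameBlock_of_forall hlt fun t ht hti => ?_)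
    have hs : (I.filter fun t => t ≤ (i : ℕ)) ⊆ I.filter fun t => t ≤ (i' : ℕ) := fun t ht => by
      rw [Finset.mem_filter] at ht ⊢
      exact ⟨ht.1, ht.2.trans hlt.le⟩
    have h3 := Finset.eq_of_subset_of_card_le hs heq.ge
    exact (Finset.mem_filter.1 (h3.symm ▸ Finset.mem_filter.2 ⟨ht, hti⟩ :
      t ∈ I.filter fun t => t ≤ (i : ℕ))).2

/-- Uniqueness of the permutation belonging to a reduced matrix. -/
theorem IsReduced.perm_unique {I : Finset ℕ} {E E' : LI n I k}
    {σ σ' : Equiv.Perm (Fin n)} (h : IsReduced I ((toMat E).submatrix id σ))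
    (h' : IsReduced I ((toMat E').submatrix id σ')) {q q' : Matrix (Fin n) (Fin n) k}
    (hq : ∀ i j, Below I i j → q i j = 0) (hq' : ∀ i j, Below I i j → q' i j = 0)
    (e : q * (toMat E).submatrix id σ = (toMat E').submatrix id σ')
    (e' : q' * (toMat E').submatrix id σ' = (toMat E).submatrix id σ) : σ = σ' := by
  have := pivPerm_congr (I := I) (A := (toMat E).submatrix id σ)
    (A' := (toMat E').submatrix id σ') fun t ht => Finset.Subset.antisymm
      (by conv_lhs => rw [← e']
          exact piv_mul_subset hq' ht)
      (by conv_lhs => rw [← e]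
          exact piv_mul_subset hq ht)
  rw [← h.symm_eq_pivPerm, ← h'.symm_eq_pivPerm] at this
  simpa using congrArg Equiv.symm this

end Pivots

/-! ### Reduction of an invertible matrix over a local ring to the form B P_σ -/

section Local

variable {n : ℕ} {O : Type*} [CommRing O] [IsLocalRing O]

/-- An element of `L_I(R)` from a matrix with the prescribed entries outside the lower blocks. -/
def mkLI {I : Finset ℕ} {R : Type*} [CommRing R] (B : Matrix (Fin n) (Fin n) R)
    (h : ∀ i j, ¬ Below I i j → B i j = (1 : Matrix (Fin n) (Fin n) R) i j) : LI n I R :=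
  ⟨⟨B, by
    rw [Matrix.det_of_isLowerTriangular]
    · exact Finset.prod_eq_one fun i _ => by
        rw [h i i (not_below_of_le le_rfl), Matrix.one_apply_eq]
    · intro i j hij
      have hlt : i < j := hij
      rw [h i j (not_below_of_le hlt.le), Matrix.one_apply_ne hlt.ne]⟩, h⟩

@[simp] theorem toMat_mkLI {I : Finset ℕ} {R : Type*} [CommRing R] (B : Matrix (Fin n) (Fin n) R)
    (h : ∀ i j, ¬ Below I i j → B i j = (1 : Matrix (Fin n) (Fin n) R) i j) :
    toMat (mkLI B h) = B := rfl

theorem toMat_injective {I : Finset ℕ} {R : Type*} [CommRing R] :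
    Function.Injective (toMat : LI n I R → Matrix (Fin n) (Fin n) R) :=
  fun _ _ h => Subtype.ext (Subtype.ext h)

/-- Reduction modulo the maximal ideal. -/
noncomputable def reduceLI {I : Finset ℕ} (B : LI n I O) : LI n I (IsLocalRing.ResidueField O) :=
  mkLI ((toMat B).map (IsLocalRing.residue O)) fun i j h => by
    rw [Matrix.map_apply, toMat_lower B h, Matrix.one_apply, Matrix.one_apply]
    split_ifs <;> simp

theorem mem_fiber_iff {I : Finset ℕ} {E : LI n I (IsLocalRing.ResidueField O)} {B : LI n I O} :
    B ∈ fiber E ↔ reduceLI B = E := by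
  rw [← toMat_injective.eq_iff]; rfl

/-- The block of i starts at the largest element of I that is ≤ i; inserting 0 covers the first
block. -/
theorem exists_blockStart (I : Finset ℕ) (i : Fin n) :
    ∃ t, (t ∈ I ∨ t = 0) ∧ ∀ i', ¬ Below I i i' ↔ t ≤ (i' : ℕ) := by
  have hne : (insert 0 (I.filter fun t => t ≤ (i : ℕ))).Nonempty := ⟨0, by simp⟩
  refine ⟨Finset.max' _ hne, ?_, fun i' => ?_⟩
  · have := Finset.max'_mem _ hne
    rw [Finset.mem_insert, Finset.mem_filter] at this
    tauto
  · rw [Finset.max'_le_iff]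
    simp only [Below, Finset.mem_insert, Finset.mem_filter]
    push Not
    constructor
    · rintro h t (rfl | ⟨h1, h2⟩)
      · exact Nat.zero_le _
      · by_contra h3
        exact absurd (h t h1 (by omega)) (by omega)
    · intro h t ht hlt
      by_contra h3
      have := h t (Or.inr ⟨ht, by omega⟩)
      omega

theorem map_vecMul_residue {T : Type*} [Fintype T] {m : Type*} (w : T → O) (A : Matrix T m O)
    (j : m) : IsLocalRing.residue O (Matrix.vecMul w A j) =
      Matrix.vecMul (IsLocalRing.residue O ∘ w) (A.map (IsLocalRing.residue O)) j :=
  RingHom.map_vecMul _ _ _ _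

/-- The row of the reduced matrix with its leading one in the column `pivPerm i`. -/
theorem exists_reduced_row {I : Finset ℕ} (hI : ∀ t ∈ I, t ≤ n) {A : Matrix (Fin n) (Fin n) O}
    (hA : IsUnit (A.map (IsLocalRing.residue O))) (i : Fin n) :
    ∃ w : Fin n → O, (∀ i', Below I i i' → w i' = 0) ∧
      (∀ i', ¬ Below I i i' → Matrix.vecMul w A
        (pivPerm I (A.map (IsLocalRing.residue O)) i') = (1 : Matrix (Fin n) (Fin n) O) i i') ∧
      ∀ j < pivPerm I (A.map (IsLocalRing.residue O)) i,
        IsLocalRing.residue O (Matrix.vecMul w A j) = 0 := by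
  classical
  set Ab := A.map (IsLocalRing.residue O) with hAb
  set c := pivPerm I Ab with hc
  obtain ⟨t, ht, hbel⟩ := exists_blockStart I i
  let T := {i : Fin n // t ≤ (i : ℕ)}
  have hi : t ≤ (i : ℕ) := (hbel i).1 (not_below_of_le le_rfl)
  have hinj := vecMul_botRows_injective hA t
  -- The rows from the start of the block of i onwards, restricted to their leading columns modulo
  -- 𝔪: a square matrix whose reduction is injective by `leadRestrict_injective`, hence N is
  -- invertible. A row of its inverse supplies the coefficients of the reduced row.
  let N : Matrix T T O := A.submatrix Subtype.val (fun i => c i)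
  have hNb : Function.Injective fun w : T → IsLocalRing.ResidueField O =>
      Matrix.vecMul w (N.map (IsLocalRing.residue O)) := by
    intro w w' h
    refine leadRestrict_injective hinj (funext fun j => ?_)
    have hj : t ≤ ((c.symm j : Fin n) : ℕ) := by
      rw [← pivPerm_mem_piv hI hA ht]
      rw [← hc, Equiv.apply_symm_apply]
      exact j.2
    have := congrFun h ⟨c.symm j, hj⟩
    simpa [N, Matrix.vecMul, dotProduct, leadRestrict, hAb] using this
  have hN : IsUnit N.det := by
    rw [← isUnit_map_iff (IsLocalRing.residue O), RingHom.map_det]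
    exact (Matrix.isUnit_iff_isUnit_det _).1 (Matrix.vecMul_injective_iff_isUnit.1 hNb)
  set w0 : T → O := N⁻¹ ⟨i, hi⟩ with hw0
  have hw0N : ∀ i' : T, Matrix.vecMul w0 N i' = (1 : Matrix (Fin n) (Fin n) O) i i' := by
    intro i'
    have : (N⁻¹ * N) ⟨i, hi⟩ i' = (1 : Matrix T T O) ⟨i, hi⟩ i' := by
      rw [Matrix.nonsing_inv_mul _ hN]
    refine Eq.trans this ?_
    simp only [Matrix.one_apply, Subtype.ext_iff]
  have hval : ∀ i' : T, Matrix.vecMul (extendZero t w0) A (c i') =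
      (1 : Matrix (Fin n) (Fin n) O) i i' := by
    intro i'
    rw [extendZero_vecMul, ← hw0N]
    rfl
  refine ⟨extendZero t w0, fun i' h => dif_neg fun h' => (hbel i').2 h' h,
    fun i' h => hval ⟨i', (hbel i').1 h⟩, ?_⟩
  set v := IsLocalRing.residue O ∘ extendZero t w0 with hv
  have hvA : ∀ j, IsLocalRing.residue O (Matrix.vecMul (extendZero t w0) A j) =
      Matrix.vecMul v Ab j := map_vecMul_residue _ _
  have hne : Matrix.vecMul v Ab ≠ 0 := by
    intro h
    have h1 := hvA (c i)
    rw [hval ⟨i, hi⟩, h] at h1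
    simp at h1
  -- The leading column of the reduction must be one of the pivot columns. On these the row is a
  -- unit vector, so it is the column of i.
  obtain ⟨j0, hj0, hlt⟩ := exists_lead hne
  have hmem : j0 ∈ piv Ab t := by
    refine mem_piv.2 ⟨v, fun l hl => ?_, hj0, hlt⟩
    simp [hv, extendZero, not_le.2 hl]
  have hj0' : t ≤ ((c.symm j0 : Fin n) : ℕ) := by
    rw [← pivPerm_mem_piv hI hA ht, ← hc]
    simpa using hmem
  have hj0c : c i = j0 := by
    by_contra hcon
    refine hj0 ?_
    have := hval ⟨c.symm j0, hj0'⟩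
    simp only [Equiv.apply_symm_apply] at this
    rw [← hvA, this, Matrix.one_apply_ne, map_zero]
    rintro h
    exact hcon (by rw [h]; simp)
  intro j hj
  rw [hvA]
  exact hlt j (hj0c ▸ hj)

/-- Every invertible matrix is block upper triangular times `B P_σ`, with `B ∈ L_I(O)` and the
reduction of `B P_σ` reduced. -/
theorem exists_reduced {I : Finset ℕ} (hI : ∀ t ∈ I, t ≤ n) {A : Matrix (Fin n) (Fin n) O}
    (hA : IsUnit A) : ∃ (q : Matrix (Fin n) (Fin n) O) (B : LI n I O) (σ : Equiv.Perm (Fin n)),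
      IsUnit q ∧ (∀ i j, Below I i j → q i j = 0) ∧ q * A = (toMat B).submatrix id σ ∧
      IsReduced I ((toMat (reduceLI B)).submatrix id σ) := by
  have hAb : IsUnit (A.map (IsLocalRing.residue O)) :=
    hA.map ((IsLocalRing.residue O).mapMatrix)
  set c := pivPerm I (A.map (IsLocalRing.residue O)) with hc
  choose q hq1 hq2 hq3 using exists_reduced_row hI hAb
  have hB : ∀ i j, ¬ Below I i j → (Matrix.of q * A).submatrix id c i j =
      (1 : Matrix (Fin n) (Fin n) O) i j := fun i j h => hq2 i j h
  set B := mkLI _ hB with hBdef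
  have hqA : Matrix.of q * A = (toMat B).submatrix id c.symm := by
    ext i j
    simp [hBdef]
  have hu : IsUnit ((toMat B).submatrix id c.symm) :=
    isUnit_submatrix_perm (isUnit_toMat B) _
  refine ⟨Matrix.of q, B, c.symm, ?_, hq1, hqA, ?_⟩
  · rw [← hqA, Matrix.isUnit_iff_isUnit_det, Matrix.det_mul] at hu
    rw [Matrix.isUnit_iff_isUnit_det]
    exact isUnit_of_mul_isUnit_left hu
  · refine ⟨isUnit_submatrix_perm (isUnit_toMat _) _, c, fun i => ⟨?_, fun j hj => ?_⟩, ?_, ?_⟩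
    · simp [toMat_diag]
    · rw [isUnit_iff_ne_zero, not_not]
      refine Eq.trans ?_ (hq3 i j hj)
      rw [show toMat (reduceLI B) = (toMat B).map (IsLocalRing.residue O) from rfl]
      simp only [Matrix.submatrix_apply, Matrix.map_apply, id, hBdef, toMat_mkLI,
        Equiv.apply_symm_apply]
      rfl
    · intro i i' h
      simp [toMat_of_lt _ h]
    · intro i i' hlt hs
      have h2 := (Tuple.eq_sort_iff.1 (rfl : c = Tuple.sort _)).2 i i' hlt
      refine h2 ?_
      unfold blockLabel
      congr 1
      refine Finset.filter_congr fun t ht => ?_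
      rw [hc, pivPerm_mem_piv hI hAb (Or.inl ht), pivPerm_mem_piv hI hAb (Or.inl ht)]
      constructor
      · intro h; have : (i : ℕ) < i' := hlt; omega
      · intro h
        by_contra h'
        exact hs.2 ⟨t, ht, by omega, h⟩

/-- For every `E` there is a permutation of its columns that makes it reduced. -/
theorem tau_pos {k : Type*} [Field k] (I : Finset ℕ) (E : LI n I k) :
    0 < tau I E := by
  -- The sign makes sorting put the columns of later blocks first within the order by `β`, keeping
  -- the order inside each block. For a position in a lower block, the column of its row's diagonal
  -- 1 then comes before the column of the entry, so the diagonal 1's are leading whatever E is.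
  let β : Fin n → ℤ := fun i => -((I.filter fun t => t ≤ (i : ℕ)).card : ℤ)
  set ρ := Tuple.sort β with hρ
  obtain ⟨hmono, htie⟩ := Tuple.eq_sort_iff.1 hρ
  have hlt : ∀ i i' : Fin n, Below I i i' → ρ.symm i < ρ.symm i' := by
    intro i i' h
    by_contra hle
    have := hmono (not_lt.1 hle)
    simp only [Function.comp_apply, Equiv.apply_symm_apply, β, neg_le_neg_iff, Nat.cast_le] at this
    refine absurd this (not_le.2 (Finset.card_lt_card ?_))
    obtain ⟨t, ht, h1, h2⟩ := h
    rw [Finset.ssubset_iff_of_subset]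
    · exact ⟨t, by simp [ht, h2], by simp [ht, h1]⟩
    · intro s hs
      rw [Finset.mem_filter] at hs ⊢
      exact ⟨hs.1, by omega⟩
  have hred : IsReduced I ((toMat E).submatrix id ρ) := by
    refine ⟨isUnit_submatrix_perm (isUnit_toMat E) _, ρ.symm, fun i => ⟨by simp [toMat_diag],
      fun j hj => ?_⟩, fun i i' h => by simp [toMat_of_lt _ h], fun i i' h hs => ?_⟩
    · rw [isUnit_iff_ne_zero, not_not]
      simp only [Matrix.submatrix_apply, id]
      have hb : ¬ Below I i (ρ j) := fun hb => by
        have := hlt _ _ hb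
        rw [Equiv.symm_apply_apply] at this
        exact lt_asymm this hj
      rw [toMat_lower E hb, Matrix.one_apply_ne]
      rintro rfl
      simp at hj
    · by_contra hle
      have hlt' : ρ.symm i' < ρ.symm i := lt_of_le_of_ne (not_lt.1 hle) (by simpa using h.ne')
      have hβ : β i' = β i := by
        simp only [β]
        congr 3
        refine Finset.filter_congr fun t ht => ?_
        constructor
        · intro h1
          by_contra h2
          exact hs.2 ⟨t, ht, by omega, h1⟩
        · intro h1
          have : (i : ℕ) < i' := h
          omega
      have := htie _ _ hlt' (by simpa using hβ)
      simp only [Equiv.apply_symm_apply] at this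
      exact lt_asymm this h
  have : Nonempty {σ : Equiv.Perm (Fin n) // IsReduced I ((toMat E).submatrix id σ)} := ⟨⟨ρ, hred⟩⟩
  exact Nat.card_pos

end Local

/-! ### Weights and the group of matrices divisible by them -/

section Weights

variable {n : ℕ} {I : Finset ℕ} {R : Type*} [CommRing R]

/-- The product of the `x ι` with `j < ι ≤ i`. -/
def wt (x : I → R) (i j : Fin n) : R :=
  ∏ ι ∈ Finset.univ.filter (fun ι : I => (j : ℕ) < (ι : ℕ) ∧ (ι : ℕ) ≤ (i : ℕ)), x ι

/-- The product of the `x ι` with `i < ι`. -/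
def dg (x : I → R) (i : Fin n) : R :=
  ∏ ι ∈ Finset.univ.filter (fun ι : I => (i : ℕ) < (ι : ℕ)), x ι

theorem wt_of_not_below (x : I → R) {i j : Fin n} (h : ¬ Below I i j) : wt x i j = 1 := by
  rw [wt, Finset.filter_false_of_mem, Finset.prod_empty]
  exact fun ι _ hι => h ⟨ι, ι.2, hι⟩

/-- Every ι separating j from i separates j from l or l from i. This makes divisibility by the
weights stable under matrix products. -/
theorem wt_dvd_mul (x : I → R) (i j l : Fin n) : wt x i j ∣ wt x i l * wt x l j := by
  classical
  rw [wt, wt, wt, ← Finset.prod_union_inter]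
  refine Dvd.dvd.mul_right (Finset.prod_dvd_prod_of_subset _ _ _ fun ι => ?_) _
  simp only [Finset.mem_filter, Finset.mem_univ, true_and, Finset.mem_union]
  omega

theorem dg_mul_wt (x : I → R) {i j : Fin n} (h : j ≤ i) : dg x i * wt x i j = dg x j := by
  classical
  have hji : (j : ℕ) ≤ i := h
  rw [dg, wt, dg, ← Finset.prod_union]
  · congr 1
    ext ι
    simp only [Finset.mem_filter, Finset.mem_univ, true_and, Finset.mem_union]
    omega
  · rw [Finset.disjoint_left]
    intro ι
    simp only [Finset.mem_filter, Finset.mem_univ, true_and]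
    omega

theorem dg_dvd_dg (x : I → R) {i j : Fin n} (h : i ≤ j) : dg x j ∣ dg x i :=
  ⟨_, (dg_mul_wt x h).symm⟩

theorem dg_ne_zero [IsDomain R] {x : I → R} (hx : ∀ ι, x ι ≠ 0) (i : Fin n) : dg x i ≠ 0 :=
  Finset.prod_ne_zero_iff.2 fun ι _ => hx ι

/-- This expresses integrality of the entries of D g D⁻¹ without dividing; on and above the diagonal
both sides hold trivially. -/
theorem dg_dvd_mul_iff [IsDomain R] {x : I → R} (hx : ∀ ι, x ι ≠ 0) (i j : Fin n) (a : R) :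
    dg x j ∣ dg x i * a ↔ wt x i j ∣ a := by
  rcases le_total j i with h | h
  · rw [← dg_mul_wt x h, mul_dvd_mul_iff_left (dg_ne_zero hx i)]
  · rw [wt_of_not_below x (not_below_of_le h)]
    simp [(dg_dvd_dg x h).mul_right a]

/-- The inverse of a matrix with entries divisible by the weights has the same property. -/
theorem wt_dvd_of_mul_eq_one [IsDomain R] {x : I → R} (hx : ∀ ι, x ι ≠ 0)
    {g g' : Matrix (Fin n) (Fin n) R} (hg : ∀ i j, wt x i j ∣ g i j) (h : g * g' = 1) (i j) :
    wt x i j ∣ g' i j := by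
  -- Here U = D g D⁻¹. Cancelling det D shows det U = det g, a unit, so D g⁻¹ D⁻¹ = U⁻¹ is integral
  -- as well.
  choose U hU using fun i j => (dg_dvd_mul_iff hx i j (g i j)).2 (hg i j)
  have e : Matrix.diagonal (dg x) * g = Matrix.of U * Matrix.diagonal (dg x) := by
    ext i j
    rw [Matrix.diagonal_mul, Matrix.mul_diagonal, hU, mul_comm]; rfl
  have hD : (Matrix.diagonal (dg x) : Matrix (Fin n) (Fin n) R).det ≠ 0 := by
    rw [Matrix.det_diagonal]
    exact Finset.prod_ne_zero_iff.2 fun i _ => dg_ne_zero hx i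
  have hdet := congrArg Matrix.det e
  rw [Matrix.det_mul, Matrix.det_mul, mul_comm] at hdet
  have hdU := mul_right_cancel₀ hD hdet
  have hunit : IsUnit (Matrix.of U).det := by
    rw [← hdU]
    exact IsUnit.of_mul_eq_one g'.det (by rw [← Matrix.det_mul, h, Matrix.det_one])
  have e' : Matrix.diagonal (dg x) * g' = (Matrix.of U)⁻¹ * Matrix.diagonal (dg x) := by
    calc Matrix.diagonal (dg x) * g' =
        (Matrix.of U)⁻¹ * (Matrix.of U * Matrix.diagonal (dg x)) * g' := by
          rw [← Matrix.mul_assoc (Matrix.of U)⁻¹, Matrix.nonsing_inv_mul _ hunit, Matrix.one_mul]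
      _ = _ := by rw [← e, Matrix.mul_assoc, Matrix.mul_assoc, h, Matrix.mul_one]
  have := congrFun (congrFun e' i) j
  rw [Matrix.diagonal_mul, Matrix.mul_diagonal] at this
  exact (dg_dvd_mul_iff hx i j _).1 (this ▸ Dvd.intro_left _ rfl)

theorem toMat_mul (B B' : LI n I R) : toMat (B * B') = toMat B * toMat B' := rfl

theorem toMat_one : toMat (1 : LI n I R) = 1 := rfl

theorem toMat_mul_inv (B : LI n I R) : toMat B * toMat B⁻¹ = 1 := by
  rw [← toMat_mul, mul_inv_cancel, toMat_one]

/-- The elements of `L_I(R)` whose entries, and those of their inverses, are divisible by the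
weights. -/
def wtSubgroup (n : ℕ) (x : I → R) : Subgroup (LI n I R) where
  carrier := {B | (∀ i j, wt x i j ∣ toMat B i j) ∧ ∀ i j, wt x i j ∣ toMat B⁻¹ i j}
  one_mem' := by
    have : ∀ i j : Fin n, wt x i j ∣ (1 : Matrix (Fin n) (Fin n) R) i j := by
      intro i j
      by_cases h : i = j
      · subst h; rw [wt_of_not_below x (not_below_of_le le_rfl)]; exact one_dvd _
      · rw [Matrix.one_apply_ne h]; exact dvd_zero _
    exact ⟨this, by rw [inv_one]; exact this⟩
  mul_mem' := by
    have key : ∀ M N : Matrix (Fin n) (Fin n) R, (∀ i j, wt x i j ∣ M i j) →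
        (∀ i j, wt x i j ∣ N i j) → ∀ i j, wt x i j ∣ (M * N) i j := fun M N hM hN i j => by
      rw [Matrix.mul_apply]
      exact Finset.dvd_sum fun l _ => (wt_dvd_mul x i j l).trans (mul_dvd_mul (hM i l) (hN l j))
    rintro A B ⟨hA, hA'⟩ ⟨hB, hB'⟩
    refine ⟨key _ _ hA hB, ?_⟩
    rw [mul_inv_rev]
    exact key _ _ hB' hA'
  inv_mem' := by
    rintro B ⟨h, h'⟩
    exact ⟨h', by rwa [inv_inv]⟩

/-- For nonzero parameters in a domain, the condition on the inverse follows by conjugation with D.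
-/
theorem mem_wtSubgroup [IsDomain R] {x : I → R} (hx : ∀ ι, x ι ≠ 0) {B : LI n I R} :
    B ∈ wtSubgroup n x ↔ ∀ i j, wt x i j ∣ toMat B i j :=
  ⟨fun h => h.1, fun h => ⟨h, wt_dvd_of_mul_eq_one hx h (toMat_mul_inv B)⟩⟩

end Weights

/-! ### Lattices spanned by the rows of `x₀ D(x) X` -/

section Lattices

variable {n : ℕ} {I : Finset ℕ} {R : Type*} [CommRing R]

/-- The span of the rows of `x₀ D(x) X`. -/
def lat (x₀ : R) (x : I → R) (X : Matrix (Fin n) (Fin n) R) : Submodule R (Fin n → R) :=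
  Submodule.span R (Set.range (x₀ • (Matrix.diagonal (dg x) * X)).row)

theorem mem_span_rows {M : Matrix (Fin n) (Fin n) R} {v : Fin n → R} :
    v ∈ Submodule.span R (Set.range M.row) ↔ ∃ w, Matrix.vecMul w M = v := by
  rw [Submodule.mem_span_range_iff_exists_fun]
  refine exists_congr fun w => ?_
  rw [Matrix.vecMul_eq_sum]
  rfl

theorem lat_row (x₀ : R) (x : I → R) (X : Matrix (Fin n) (Fin n) R) (i : Fin n) :
    (x₀ • (Matrix.diagonal (dg x) * X)).row i = x₀ • dg x i • X i := by
  ext j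
  simp [Matrix.row, Matrix.diagonal_mul]

theorem mul_closed_iff (M : Matrix (Fin n) (Fin n) R) :
    (∀ a ∈ Submodule.span R (Set.range M.row), ∀ b ∈ Submodule.span R (Set.range M.row),
      a * b ∈ Submodule.span R (Set.range M.row)) ↔
      ∀ i i', i ≤ i' → M.row i * M.row i' ∈ Submodule.span R (Set.range M.row) := by
  constructor
  · exact fun h i i' _ => h _ (Submodule.subset_span ⟨i, rfl⟩) _ (Submodule.subset_span ⟨i', rfl⟩)
  · intro h a ha b hb
    have hall : ∀ i i', M.row i * M.row i' ∈ Submodule.span R (Set.range M.row) := by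
      intro i i'
      rcases le_total i i' with hi | hi
      · exact h i i' hi
      · rw [mul_comm]; exact h i' i hi
    induction ha, hb using Submodule.span_induction₂ with
    | mem_mem a b ha hb =>
      obtain ⟨i, rfl⟩ := ha
      obtain ⟨i', rfl⟩ := hb
      exact hall i i'
    | zero_left => rw [zero_mul]; exact zero_mem _
    | zero_right => rw [mul_zero]; exact zero_mem _
    | add_left _ _ _ _ _ _ h1 h2 => rw [add_mul]; exact add_mem h1 h2
    | add_right _ _ _ _ _ _ h1 h2 => rw [mul_add]; exact add_mem h1 h2
    | smul_left c _ _ _ _ h1 => rw [smul_mul_assoc]; exact Submodule.smul_mem _ _ h1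
    | smul_right c _ _ _ _ h1 => rw [mul_smul_comm]; exact Submodule.smul_mem _ _ h1

theorem submatrix_mul_inv (B : LI n I R) (σ : Equiv.Perm (Fin n)) :
    (toMat B).submatrix id σ * (toMat B⁻¹).submatrix σ id = 1 := by
  rw [Matrix.submatrix_mul_equiv, toMat_mul_inv, Matrix.submatrix_id_id]

variable [IsDomain R] {x₀ : R} {x : I → R}

/-- The entries of v Y are the coordinates of v with respect to the rows of X, and the lattice
scales the j-th of these rows by x₀ `dg x j`. -/
theorem mem_lat_iff (h0 : x₀ ≠ 0) {X Y : Matrix (Fin n) (Fin n) R} (hXY : X * Y = 1)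
    (v : Fin n → R) : x₀ • v ∈ lat x₀ x X ↔ ∀ j, dg x j ∣ Matrix.vecMul v Y j := by
  have hYX : Y * X = 1 := mul_eq_one_comm.1 hXY
  rw [lat, mem_span_rows]
  have hw : ∀ w : Fin n → R, Matrix.vecMul w (x₀ • (Matrix.diagonal (dg x) * X)) = x₀ • v ↔
      (fun j => w j * dg x j) = Matrix.vecMul v Y := by
    intro w
    rw [Matrix.vecMul_smul, (smul_right_injective (Fin n → R) h0).eq_iff,
      ← Matrix.vecMul_vecMul]
    have hd : Matrix.vecMul w (Matrix.diagonal (dg x)) = fun j => w j * dg x j := by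
      ext j; exact Matrix.vecMul_diagonal _ _ _
    rw [hd]
    constructor
    · rintro rfl; rw [Matrix.vecMul_vecMul, hXY, Matrix.vecMul_one]
    · intro h; rw [h, Matrix.vecMul_vecMul, hYX, Matrix.vecMul_one]
  simp only [hw]
  constructor
  · rintro ⟨w, h⟩ j
    rw [← h]; exact Dvd.intro_left _ rfl
  · intro h
    choose w hw' using h
    exact ⟨w, funext fun j => by rw [hw' j, mul_comm]⟩

theorem lat_le_iff (h0 : x₀ ≠ 0) (hx : ∀ ι, x ι ≠ 0) {X X' Y' : Matrix (Fin n) (Fin n) R}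
    (hXY : X' * Y' = 1) :
    lat x₀ x X ≤ lat x₀ x X' ↔ ∀ i j, wt x i j ∣ (X * Y') i j := by
  rw [lat, Submodule.span_le, Set.range_subset_iff]
  refine forall_congr' fun i => ?_
  rw [lat_row, SetLike.mem_coe, mem_lat_iff h0 hXY]
  refine forall_congr' fun j => ?_
  rw [Matrix.smul_vecMul, Pi.smul_apply, smul_eq_mul, dg_dvd_mul_iff hx]
  rfl

/-- One inclusion suffices: the change of basis is invertible over R, and its inverse inherits the
divisibilities. -/
theorem lat_eq_iff (h0 : x₀ ≠ 0) (hx : ∀ ι, x ι ≠ 0) {X Y X' Y' : Matrix (Fin n) (Fin n) R}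
    (hXY : X * Y = 1) (hXY' : X' * Y' = 1) :
    lat x₀ x X = lat x₀ x X' ↔ ∀ i j, wt x i j ∣ (X * Y') i j := by
  rw [le_antisymm_iff, lat_le_iff h0 hx hXY', lat_le_iff h0 hx hXY, and_iff_left_iff_imp]
  intro h
  refine wt_dvd_of_mul_eq_one hx h ?_
  rw [Matrix.mul_assoc, ← Matrix.mul_assoc Y', mul_eq_one_comm.1 hXY', Matrix.one_mul, hXY]

/-- The lattice spanned by the rows of `x₀ D(x) B P_σ` is closed under multiplication if and only
if the divisibility conditions hold. -/
theorem lat_mul_closed_iff (h0 : x₀ ≠ 0) (hx : ∀ ι, x ι ≠ 0) (B : LI n I R)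
    (σ : Equiv.Perm (Fin n)) :
    (∀ a ∈ lat x₀ x ((toMat B).submatrix id σ), ∀ b ∈ lat x₀ x ((toMat B).submatrix id σ),
      a * b ∈ lat x₀ x ((toMat B).submatrix id σ)) ↔ DivCond x₀ x B := by
  have hterm : ∀ j i i' : Fin n, i ≤ i' →
      Matrix.vecMul ((toMat B).submatrix id σ i * (toMat B).submatrix id σ i')
        ((toMat B⁻¹).submatrix σ id) j =
      ∑ k ∈ Finset.Iic i, toMat B i k * toMat B i' k * toMat B⁻¹ k j := by
    intro j i i' _
    rw [Matrix.vecMul, dotProduct]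
    simp only [Pi.mul_apply, Matrix.submatrix_apply, id]
    -- A permutation of the coordinates only reindexes the sum, which is why closure under
    -- multiplication does not depend on σ.
    rw [Equiv.sum_comp σ fun k => toMat B i k * toMat B i' k * toMat B⁻¹ k j]
    symm
    refine Finset.sum_subset (Finset.subset_univ _) fun k _ hk => ?_
    rw [toMat_of_lt B (not_le.1 fun h => hk (Finset.mem_Iic.2 h)), zero_mul, zero_mul]
  rw [lat, mul_closed_iff, ← lat]
  have hrow : ∀ i i', i ≤ i' → (((x₀ • (Matrix.diagonal (dg x) *
      (toMat B).submatrix id σ)).row i * (x₀ • (Matrix.diagonal (dg x) *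
      (toMat B).submatrix id σ)).row i') ∈ lat x₀ x ((toMat B).submatrix id σ) ↔
      ∀ j, wt x i j ∣ x₀ * dg x i' *
        ∑ k ∈ Finset.Iic i, toMat B i k * toMat B i' k * toMat B⁻¹ k j) := by
    intro i i' hii'
    rw [lat_row, lat_row, smul_mul_assoc, mem_lat_iff h0 (submatrix_mul_inv B σ)]
    refine forall_congr' fun j => ?_
    rw [← dg_dvd_mul_iff hx, ← hterm j i i' hii']
    rw [smul_mul_assoc, mul_smul_comm, mul_smul_comm, Matrix.smul_vecMul, Matrix.smul_vecMul,
      Matrix.smul_vecMul]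
    simp only [Pi.smul_apply, smul_eq_mul, mul_assoc]
  constructor
  · intro h j i i' _ hii'
    exact (hrow i i' hii').1 (h i i' hii') j
  · intro h i i' hii'
    refine (hrow i i' hii').2 fun j => ?_
    -- For j ≥ i the weight is 1, so only the conditions with j < i carry information.
    by_cases hj : j < i
    · exact h j i i' hj hii'
    · rw [wt_of_not_below x (not_below_of_le (not_lt.1 hj))]
      exact one_dvd _

end Lattices

/-! ### Classification of the subalgebras of a given type -/

section Classification

/-- With a = x₀ ∏ x_ι the lattice contains a R^n, so the quotient is an image of the finite set
(R/a)^n. -/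
theorem finite_quotient_lat {n : ℕ} {I : Finset ℕ} {R : Type*} [CommRing R] [IsDomain R]
    (hfin : ∀ a : R, a ≠ 0 → Finite (R ⧸ Ideal.span {a})) {x₀ : R} {x : I → R}
    (h0 : x₀ ≠ 0) (hx : ∀ ι, x ι ≠ 0) {X Y : Matrix (Fin n) (Fin n) R} (hXY : X * Y = 1) :
    Finite ((Fin n → R) ⧸ lat x₀ x X) := by
  set a := x₀ * ∏ ι, x ι with ha
  have := hfin a (mul_ne_zero h0 (Finset.prod_ne_zero_iff.2 fun ι _ => hx ι))
  let f : (Fin n → R ⧸ Ideal.span {a}) → (Fin n → R) ⧸ lat x₀ x X :=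
    fun u => Submodule.Quotient.mk fun i => Quotient.out (u i)
  refine Finite.of_surjective f fun v => ?_
  obtain ⟨v, rfl⟩ := Submodule.Quotient.mk_surjective _ v
  refine ⟨fun i => Ideal.Quotient.mk _ (v i), ?_⟩
  rw [Submodule.Quotient.eq]
  have h : ∀ i, ∃ c, Quotient.out (Ideal.Quotient.mk (Ideal.span {a}) (v i)) - v i = a * c := by
    intro i
    have : Ideal.Quotient.mk (Ideal.span {a})
        (Quotient.out (Ideal.Quotient.mk (Ideal.span {a}) (v i))) =
        Ideal.Quotient.mk (Ideal.span {a}) (v i) := Quotient.out_eq _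
    rw [Ideal.Quotient.eq, Ideal.mem_span_singleton] at this
    exact this
  choose c hc using h
  have e : ((fun i => Quotient.out (Ideal.Quotient.mk (Ideal.span {a}) (v i))) - v) =
      x₀ • ((∏ ι, x ι) • c) := by
    ext i
    rw [Pi.sub_apply, hc, ha, Pi.smul_apply, Pi.smul_apply, smul_eq_mul, smul_eq_mul, mul_assoc]
  rw [e, mem_lat_iff h0 hXY]
  intro j
  rw [Matrix.smul_vecMul, Pi.smul_apply, smul_eq_mul]
  exact (Finset.prod_dvd_prod_of_subset _ _ _ (Finset.subset_univ _)).mul_right _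

theorem lat_perm_eq_iff {n : ℕ} {I : Finset ℕ} {O : Type*} [CommRing O] [IsDomain O]
    {x₀ : O} {x : I → O} (h0 : x₀ ≠ 0) (hx : ∀ ι, x ι ≠ 0)
    (B B' : LI n I O) (σ : Equiv.Perm (Fin n)) :
    lat x₀ x ((toMat B).submatrix id σ) = lat x₀ x ((toMat B').submatrix id σ) ↔
      B * B'⁻¹ ∈ wtSubgroup n x := by
  rw [lat_eq_iff h0 hx (submatrix_mul_inv B σ) (submatrix_mul_inv B' σ), mem_wtSubgroup hx,
    Matrix.submatrix_mul_equiv, Matrix.submatrix_id_id, toMat_mul]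

/-- The divisibility conditions are a property of the lattice, which does not change under left
multiplication by the subgroup. -/
theorem divCond_mul_of_mem {n : ℕ} {I : Finset ℕ} {O : Type*} [CommRing O] [IsDomain O]
    {x₀ : O} {x : I → O} (h0 : x₀ ≠ 0) (hx : ∀ ι, x ι ≠ 0)
    {h : LI n I O} (hh : h ∈ wtSubgroup n x) {B : LI n I O} (hB : DivCond x₀ x B) :
    DivCond x₀ x (h * B) := by
  rw [← lat_mul_closed_iff h0 hx _ (Equiv.refl _)] at hB ⊢
  rwa [(lat_perm_eq_iff h0 hx (h * B) B (Equiv.refl _)).2 (by rwa [mul_inv_cancel_right])]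

variable {n : ℕ} {I : Finset ℕ} {O : Type*} [CommRing O] [IsLocalRing O]

theorem residue_wt_of_below {x : I → O} (hx : ∀ ι, x ι ∈ IsLocalRing.maximalIdeal O)
    {i j : Fin n} (h : Below I i j) : IsLocalRing.residue O (wt x i j) = 0 := by
  obtain ⟨ι, hι, h1, h2⟩ := h
  rw [IsLocalRing.residue_eq_zero_iff]
  exact Ideal.mem_of_dvd _ (Finset.dvd_prod_of_mem x (a := ⟨ι, hι⟩) (by simp [h1, h2])) (hx _)

theorem residue_of_wt_dvd {x : I → O} (hx : ∀ ι, x ι ∈ IsLocalRing.maximalIdeal O)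
    {i j : Fin n} (h : Below I i j) {a : O} (ha : wt x i j ∣ a) :
    IsLocalRing.residue O a = 0 := by
  obtain ⟨b, rfl⟩ := ha
  rw [map_mul, residue_wt_of_below hx h, zero_mul]

theorem reduceLI_mul_of_mem {x : I → O} (hx : ∀ ι, x ι ∈ IsLocalRing.maximalIdeal O)
    {h : LI n I O} (hh : h ∈ wtSubgroup n x) (B : LI n I O) :
    reduceLI (h * B) = reduceLI B := by
  apply toMat_injective
  change (toMat h * toMat B).map (IsLocalRing.residue O) = (toMat B).map (IsLocalRing.residue O)
  have h1 : (toMat h).map (IsLocalRing.residue O) = 1 := by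
    ext i j
    rw [Matrix.map_apply]
    by_cases hb : Below I i j
    · rw [residue_of_wt_dvd hx hb (hh.1 i j), Matrix.one_apply_ne]
      rintro rfl
      exact not_below_of_le le_rfl hb
    · rw [toMat_lower h hb, Matrix.one_apply, Matrix.one_apply]
      split_ifs <;> simp
  rw [Matrix.map_mul, h1, Matrix.one_mul]

variable [IsDomain O] {π : O} {r₀ : ℕ} {r : I → ℕ+}

/-- The changes of basis in both directions reduce to block upper triangular matrices, so uniqueness
of the pivots gives σ = σ'. The permutation then cancels, leaving a condition on B and B'. -/
theorem lat_reduced_eq_iff {x₀ : O} {x : I → O} (h0 : x₀ ≠ 0) (hx : ∀ ι, x ι ≠ 0)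
    (hxm : ∀ ι, x ι ∈ IsLocalRing.maximalIdeal O) {B B' : LI n I O} {σ σ' : Equiv.Perm (Fin n)}
    (hB : IsReduced I ((toMat (reduceLI B)).submatrix id σ))
    (hB' : IsReduced I ((toMat (reduceLI B')).submatrix id σ')) :
    lat x₀ x ((toMat B).submatrix id σ) = lat x₀ x ((toMat B').submatrix id σ') ↔
      σ = σ' ∧ B * B'⁻¹ ∈ wtSubgroup n x := by
  constructor
  · intro h
    have hσ : σ = σ' := by
      have key : ∀ {C C' : LI n I O} {ρ ρ' : Equiv.Perm (Fin n)},
          lat x₀ x ((toMat C).submatrix id ρ) = lat x₀ x ((toMat C').submatrix id ρ') →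
          ∃ q : Matrix (Fin n) (Fin n) (IsLocalRing.ResidueField O),
            (∀ i j, Below I i j → q i j = 0) ∧
            q * (toMat (reduceLI C')).submatrix id ρ' = (toMat (reduceLI C)).submatrix id ρ := by
        intro C C' ρ ρ' h
        refine ⟨((toMat C).submatrix id ρ * (toMat C'⁻¹).submatrix ρ' id).map
          (IsLocalRing.residue O), fun i j hb => ?_, ?_⟩
        · exact residue_of_wt_dvd hxm hb
            ((lat_eq_iff h0 hx (submatrix_mul_inv C ρ) (submatrix_mul_inv C' ρ')).1 h i j)
        · have e : ((toMat C).submatrix id ρ * (toMat C'⁻¹).submatrix ρ' id) *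
              (toMat C').submatrix id ρ' = (toMat C).submatrix id ρ := by
            rw [Matrix.mul_assoc, mul_eq_one_comm.1 (submatrix_mul_inv C' ρ'), Matrix.mul_one]
          have e2 := congrArg (fun M => M.map (IsLocalRing.residue O)) e
          simp only [Matrix.map_mul (L := (toMat C).submatrix id ρ *
            (toMat C'⁻¹).submatrix ρ' id)] at e2
          exact e2
      obtain ⟨q, hq, e⟩ := key h
      obtain ⟨q', hq', e'⟩ := key h.symm
      exact (hB'.perm_unique hB hq hq' e e').symm
    subst hσ
    exact ⟨rfl, (lat_perm_eq_iff h0 hx B B' σ).1 h⟩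
  · rintro ⟨rfl, h⟩
    exact (lat_perm_eq_iff h0 hx B B' σ).2 h

theorem mem_subalgebrasOfType_iff (hI : ∀ t ∈ I, t ≤ n)
    (hfin : ∀ a : O, a ≠ 0 → Finite (O ⧸ Ideal.span {a})) (hπ : π ≠ 0)
    {Λ : Submodule O (Fin n → O)} :
    Λ ∈ subalgebrasOfType n π I r₀ r ↔ ∃ (σ : Equiv.Perm (Fin n)) (B : LI n I O),
      IsReduced I ((toMat (reduceLI B)).submatrix id σ) ∧ B ∈ setB n π r₀ r ∧
      lat (π ^ r₀) (fun ι => π ^ (r ι : ℕ)) ((toMat B).submatrix id σ) = Λ := by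
  have h0 : π ^ r₀ ≠ 0 := pow_ne_zero _ hπ
  have hx : ∀ ι : I, π ^ (r ι : ℕ) ≠ 0 := fun ι => pow_ne_zero _ hπ
  constructor
  · rintro ⟨-, hc, A, rfl⟩
    obtain ⟨q, B, σ, hq, hqI, hqA, hred⟩ := exists_reduced hI A.isUnit
    have e : lat (π ^ r₀) (fun ι => π ^ (r ι : ℕ)) ((toMat B).submatrix id σ) =
        lat (π ^ r₀) (fun ι => π ^ (r ι : ℕ)) A.1 := by
      rw [lat_eq_iff h0 hx (submatrix_mul_inv B σ) A.mul_inv]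
      intro i j
      rw [← hqA, Matrix.mul_assoc, A.mul_inv, Matrix.mul_one]
      -- The row reduction q vanishes in the lower blocks and the weights are 1 elsewhere, so q does
      -- not change the lattice.
      by_cases hb : Below I i j
      · rw [hqI i j hb]; exact dvd_zero _
      · rw [wt_of_not_below _ hb]; exact one_dvd _
    refine ⟨σ, B, hred, (lat_mul_closed_iff h0 hx B σ).1 ?_, e⟩
    rw [e]
    exact hc
  · rintro ⟨σ, B, -, hB, rfl⟩
    exact ⟨finite_quotient_lat hfin h0 hx (submatrix_mul_inv B σ),
      (lat_mul_closed_iff h0 hx B σ).2 hB,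
      ⟨(toMat B).submatrix id σ, (toMat B⁻¹).submatrix σ id, submatrix_mul_inv B σ,
        mul_eq_one_comm.1 (submatrix_mul_inv B σ)⟩, rfl⟩

/-- The coset `H B`, encoded as the left coset of `B⁻¹`. -/
def invCoset {G : Type*} [Group G] (H : Subgroup G) (B : G) : G ⧸ H := QuotientGroup.mk B⁻¹

theorem invCoset_eq_iff {G : Type*} [Group G] {H : Subgroup G} {B B' : G} :
    invCoset H B = invCoset H B' ↔ B * B'⁻¹ ∈ H := by
  rw [invCoset, invCoset, QuotientGroup.eq, inv_inv]

theorem nonempty_equiv_range {α β γ : Type*} {f : α → β} {g : α → γ}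
    (h : ∀ a b, f a = f b ↔ g a = g b) : Nonempty (Set.range f ≃ Set.range g) :=
  ⟨(Setoid.quotientKerEquivRange f).symm.trans
    ((Quotient.congrRight h).trans (Setoid.quotientKerEquivRange g))⟩

/-- The maps sending (σ, B) to its lattice and to the triple (E, σ, HB) have the same fibres, hence
images of the same size. The entry E is determined by the coset; recording it splits the count into
a sum over E. -/
theorem subalgebrasOfType_finite_and_hNum_eq [Finite (IsLocalRing.ResidueField O)]
    (hI : ∀ t ∈ I, t ≤ n)
    (hfin : ∀ a : O, a ≠ 0 → Finite (O ⧸ Ideal.span {a})) (hπ : π ≠ 0)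
    (hπm : π ∈ IsLocalRing.maximalIdeal O)
    [(wtSubgroup n fun ι => π ^ (r ι : ℕ)).FiniteIndex] :
    (subalgebrasOfType n π I r₀ r).Finite ∧
      hNum n π I r₀ r = ∑ E : LI n I (IsLocalRing.ResidueField O), tau I E *
        (invCoset (wtSubgroup n fun ι => π ^ (r ι : ℕ)) '' (setB n π r₀ r ∩ fiber E)).ncard := by
  have h0 : π ^ r₀ ≠ 0 := pow_ne_zero _ hπ
  have hx : ∀ ι : I, π ^ (r ι : ℕ) ≠ 0 := fun ι => pow_ne_zero _ hπ
  have hxm : ∀ ι : I, π ^ (r ι : ℕ) ∈ IsLocalRing.maximalIdeal O :=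
    fun ι => Ideal.pow_mem_of_mem _ hπm _ (r ι).pos
  set x : I → O := fun ι => π ^ (r ι : ℕ) with hxdef
  let X := {p : Equiv.Perm (Fin n) × LI n I O //
    IsReduced I ((toMat (reduceLI p.2)).submatrix id p.1) ∧ p.2 ∈ setB n π r₀ r}
  let f : X → Submodule O (Fin n → O) := fun p => lat (π ^ r₀) x ((toMat p.1.2).submatrix id p.1.1)
  let g : X → LI n I (IsLocalRing.ResidueField O) × Equiv.Perm (Fin n) ×
      (LI n I O ⧸ wtSubgroup n x) := fun p =>
    (reduceLI p.1.2, p.1.1, invCoset (wtSubgroup n x) p.1.2)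
  have hfg : ∀ a b, f a = f b ↔ g a = g b := by
    intro a b
    change lat _ _ _ = lat _ _ _ ↔ _
    rw [lat_reduced_eq_iff h0 hx hxm a.2.1 b.2.1, Prod.mk.injEq, Prod.mk.injEq, invCoset_eq_iff]
    refine ⟨fun h => ⟨?_, h⟩, fun h => h.2⟩
    simpa using reduceLI_mul_of_mem hxm h.2 b.1.2
  obtain ⟨e⟩ := nonempty_equiv_range hfg
  have hS : subalgebrasOfType n π I r₀ r = Set.range f := by
    ext Λ
    rw [mem_subalgebrasOfType_iff hI hfin hπ]
    constructor
    · rintro ⟨σ, B, h1, h2, h3⟩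
      exact ⟨⟨(σ, B), h1, h2⟩, h3⟩
    · rintro ⟨⟨⟨σ, B⟩, h1, h2⟩, h3⟩
      exact ⟨σ, B, h1, h2, h3⟩
  have hfinG : Finite (LI n I O ⧸ wtSubgroup n x) := inferInstance
  have hfinite : Finite (Set.range f) := Finite.of_equiv _ e.symm
  have hmem : ∀ p : LI n I (IsLocalRing.ResidueField O) × Equiv.Perm (Fin n) ×
      (LI n I O ⧸ wtSubgroup n x), p ∈ Set.range g ↔
      IsReduced I ((toMat p.1).submatrix id p.2.1) ∧
        p.2.2 ∈ invCoset (wtSubgroup n x) '' (setB n π r₀ r ∩ fiber p.1) := by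
    rintro ⟨E, σ, c⟩
    constructor
    · rintro ⟨⟨⟨σ, B⟩, h1, h2⟩, h3⟩
      simp only [g, Prod.mk.injEq] at h3
      obtain ⟨rfl, rfl, rfl⟩ := h3
      exact ⟨h1, B, ⟨h2, mem_fiber_iff.2 rfl⟩, rfl⟩
    · rintro ⟨h1, B, ⟨h2, h3⟩, h4⟩
      rw [mem_fiber_iff] at h3
      subst h3
      exact ⟨⟨(σ, B), h1, h2⟩, congrArg (fun c => (reduceLI B, σ, c)) h4⟩
  let e2 : Set.range g ≃ Σ E : LI n I (IsLocalRing.ResidueField O),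
      {σ : Equiv.Perm (Fin n) // IsReduced I ((toMat E).submatrix id σ)} ×
        (invCoset (wtSubgroup n x) '' (setB n π r₀ r ∩ fiber E) : Set (LI n I O ⧸ wtSubgroup n x)) :=
    { toFun := fun p => ⟨p.1.1, ⟨p.1.2.1, ((hmem _).1 p.2).1⟩, ⟨p.1.2.2, ((hmem _).1 p.2).2⟩⟩
      invFun := fun p => ⟨(p.1, p.2.1.1, p.2.2.1), (hmem _).2 ⟨p.2.1.2, p.2.2.2⟩⟩
      left_inv := fun p => rfl
      right_inv := fun p => rfl }
  refine ⟨by rw [hS]; exact Set.toFinite _, ?_⟩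
  rw [hNum, hS, ← Nat.card_coe_set_eq, Nat.card_congr (e.trans e2), Nat.card_sigma]
  refine Finset.sum_congr rfl fun E _ => ?_
  rw [Nat.card_prod, Nat.card_coe_set_eq, tau]

end Classification

/-! ### Exponents of the weights, and congruences in L_I(O) -/

section WeightExponents

variable {n : ℕ} {I : Finset ℕ} {O : Type*} [CommRing O]

instance instDecidableBelow (I : Finset ℕ) (i j : Fin n) : Decidable (Below I i j) :=
  inferInstanceAs (Decidable (∃ ι ∈ I, (j : ℕ) < ι ∧ ι ≤ (i : ℕ)))

/-- The exponent of `π` in the weight `wt (π ^ r) i j`. -/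
def wtExp (r : I → ℕ) (i j : Fin n) : ℕ :=
  ∑ ι ∈ Finset.univ.filter (fun ι : I => (j : ℕ) < (ι : ℕ) ∧ (ι : ℕ) ≤ (i : ℕ)), r ι

theorem wt_pow (π : O) (r : I → ℕ) (i j : Fin n) :
    wt (fun ι => π ^ r ι) i j = π ^ wtExp r i j := by
  rw [wt, wtExp, Finset.prod_pow_eq_pow_sum]

/-- Reduction of `L_I(O)` modulo an ideal. -/
def reduceHom (n : ℕ) (I : Finset ℕ) (J : Ideal O) :
    LI n I O →* Matrix.SpecialLinearGroup (Fin n) (O ⧸ J) :=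
  (Matrix.SpecialLinearGroup.map (Ideal.Quotient.mk J)).comp (LI n I O).subtype

theorem reduceHom_eq_iff {J : Ideal O} {B B' : LI n I O} :
    reduceHom n I J B = reduceHom n I J B' ↔
      ∀ i j, Ideal.Quotient.mk J (toMat B i j) = Ideal.Quotient.mk J (toMat B' i j) :=
  Matrix.SpecialLinearGroup.ext_iff _ _

/-- After exchanging the sums, r_ι is counted once for each of the ι(n - ι) positions with j < ι ≤
i. -/
theorem sum_wtExp {n : ℕ} {I : Finset ℕ} (hI : ∀ t ∈ I, t ≤ n) (r : I → ℕ) :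
    ∑ p : {p : Fin n × Fin n // Below I p.1 p.2}, wtExp r p.1.1 p.1.2 =
      ∑ ι : I, r ι * ((ι : ℕ) * (n - (ι : ℕ))) := by
  classical
  have h1 : ∑ p : {p : Fin n × Fin n // Below I p.1 p.2}, wtExp r p.1.1 p.1.2 =
      ∑ p : Fin n × Fin n, wtExp r p.1 p.2 := by
    rw [← Finset.sum_subtype (Finset.univ.filter fun p : Fin n × Fin n => Below I p.1 p.2)
      (by simp) fun p : Fin n × Fin n => wtExp r p.1 p.2]
    refine Finset.sum_subset (Finset.subset_univ _) fun p _ hp => ?_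
    rw [wtExp, Finset.filter_false_of_mem, Finset.sum_empty]
    exact fun ι _ hι => hp (Finset.mem_filter.2 ⟨Finset.mem_univ _, ι, ι.2, hι⟩)
  rw [h1]
  simp only [wtExp, Finset.sum_filter]
  rw [Finset.sum_comm]
  refine Finset.sum_congr rfl fun ι _ => ?_
  rw [← Finset.sum_filter, Finset.sum_const, smul_eq_mul, mul_comm]
  congr 1
  have : (Finset.univ.filter fun p : Fin n × Fin n => (p.2 : ℕ) < ι ∧ (ι : ℕ) ≤ p.1) =
      (Finset.univ.filter fun i : Fin n => (ι : ℕ) ≤ i) ×ˢ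
        Finset.univ.filter fun j : Fin n => (j : ℕ) < ι := by
    ext p; simp [and_comm]
  rw [this, Finset.card_product, card_le_val, Fin.card_filter_val_lt,
    min_eq_right (hI ι ι.2), mul_comm]

end WeightExponents

/-! ### The index of the weighted subgroup -/

section Index

variable {O : Type*} [CommRing O] [IsDomain O] [IsDiscreteValuationRing O]

theorem index_span_pow {π : O} (hπ : Irreducible π) (k : ℕ) :
    (Ideal.span {π ^ k}).toAddSubgroup.index = resCard O ^ k := by
  have h1 : Ideal.span {π ^ k} = IsLocalRing.maximalIdeal O ^ k := by
    rw [hπ.maximalIdeal_eq, Ideal.span_singleton_pow]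
  rw [h1]
  exact cardQuot_pow_of_prime (IsDiscreteValuationRing.not_a_field O)

variable {n : ℕ} {I : Finset ℕ}

variable [Finite (IsLocalRing.ResidueField O)]

variable (O) in
theorem one_lt_resCard : 1 < resCard O := Finite.one_lt_card

theorem card_map_span_pow {π : O} (hπ : Irreducible π) {e N : ℕ} (h : e ≤ N) :
    Nat.card ((Ideal.span {π ^ e}).toAddSubgroup.map
      (Ideal.Quotient.mk (Ideal.span {π ^ N})).toAddMonoidHom) = resCard O ^ (N - e) := by
  rw [← AddSubgroup.relIndex_ker]
  have hker : (Ideal.Quotient.mk (Ideal.span {π ^ N})).toAddMonoidHom.ker =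
      (Ideal.span {π ^ N}).toAddSubgroup := by
    ext x
    exact Ideal.Quotient.eq_zero_iff_mem
  have hle : (Ideal.span {π ^ N}).toAddSubgroup ≤ (Ideal.span {π ^ e}).toAddSubgroup :=
    Ideal.span_singleton_le_span_singleton.2 (pow_dvd_pow π h)
  have := AddSubgroup.relIndex_mul_index hle
  rw [index_span_pow hπ, index_span_pow hπ] at this
  rw [hker]
  refine Nat.eq_of_mul_eq_mul_right (pow_pos (one_lt_resCard O).le e) ?_
  rw [this, ← pow_add, Nat.sub_add_cancel h]

/-- An element is given by free choices of its entries in the lower blocks, each in a prescribed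
ideal, so the image modulo π^N is in bijection with a product of the groups (π^e)/(π^N). -/
theorem card_map_wtSubgroup {π : O} (hπ : Irreducible π) (r : I → ℕ) {N : ℕ}
    (hN : ∀ i j : Fin n, wtExp r i j ≤ N) :
    Nat.card ((wtSubgroup n fun ι => π ^ r ι).map (reduceHom n I (Ideal.span {π ^ N}))) =
      ∏ p : {p : Fin n × Fin n // Below I p.1 p.2}, resCard O ^ (N - wtExp r p.1.1 p.1.2) := by
  set H := wtSubgroup n fun ι => π ^ r ι with hH
  set J := Ideal.span {π ^ N} with hJ
  have hx : ∀ ι : I, π ^ r ι ≠ 0 := fun ι => pow_ne_zero _ hπ.ne_zero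
  let f : H → Matrix.SpecialLinearGroup (Fin n) (O ⧸ J) := fun B => reduceHom n I J B
  let g : H → ({p : Fin n × Fin n // Below I p.1 p.2} → O ⧸ J) :=
    fun B p => Ideal.Quotient.mk J (toMat B.1 p.1.1 p.1.2)
  have hfg : ∀ a b, f a = f b ↔ g a = g b := by
    intro a b
    change reduceHom n I J a = reduceHom n I J b ↔ _
    rw [reduceHom_eq_iff]
    constructor
    · exact fun h => funext fun p => h _ _
    · intro h i j
      by_cases hb : Below I i j
      · exact congrFun h ⟨(i, j), hb⟩
      · rw [toMat_lower _ hb, toMat_lower _ hb]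
  obtain ⟨e⟩ := nonempty_equiv_range hfg
  have hf : ((H.map (reduceHom n I J) : Subgroup _) : Set _) = Set.range f := by
    ext M
    constructor
    · rintro ⟨B, hB, rfl⟩; exact ⟨⟨B, hB⟩, rfl⟩
    · rintro ⟨B, rfl⟩; exact ⟨B, B.2, rfl⟩
  let K : {p : Fin n × Fin n // Below I p.1 p.2} → AddSubgroup (O ⧸ J) := fun p =>
    (Ideal.span {π ^ wtExp r p.1.1 p.1.2}).toAddSubgroup.map (Ideal.Quotient.mk J).toAddMonoidHom
  have hg : Set.range g = Set.univ.pi fun p => (K p : Set (O ⧸ J)) := by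
    ext y
    constructor
    · rintro ⟨B, rfl⟩ p -
      refine ⟨_, ?_, rfl⟩
      have := ((mem_wtSubgroup hx).1 B.2) p.1.1 p.1.2
      rw [wt_pow] at this
      exact Ideal.mem_span_singleton.2 this
    · intro hy
      have hy' : ∀ p, ∃ a, π ^ wtExp r p.1.1 p.1.2 ∣ a ∧ Ideal.Quotient.mk J a = y p := by
        intro p
        obtain ⟨a, ha, h⟩ := hy p trivial
        exact ⟨a, Ideal.mem_span_singleton.1 ha, h⟩
      choose a ha hay using hy'
      let B : LI n I O := mkLI (fun i j => if h : Below I i j then a ⟨(i, j), h⟩ else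
        (1 : Matrix (Fin n) (Fin n) O) i j) fun i j h => dif_neg h
      have hBb : ∀ {i j} (h : Below I i j), toMat B i j = a ⟨(i, j), h⟩ := fun h => dif_pos h
      have hB : B ∈ H := by
        rw [hH, mem_wtSubgroup hx]
        intro i j
        by_cases hb : Below I i j
        · rw [wt_pow]
          rw [hBb hb]
          exact ha ⟨(i, j), hb⟩
        · rw [wt_of_not_below _ hb]; exact one_dvd _
      refine ⟨⟨B, hB⟩, funext fun p => ?_⟩
      simp only [g, hBb p.2]
      exact hay p
  calc Nat.card (H.map (reduceHom n I J)) = Nat.card (Set.range f) := by rw [← hf]; rfl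
    _ = Nat.card (Set.univ.pi fun p => (K p : Set (O ⧸ J))) := by rw [Nat.card_congr e, hg]
    _ = ∏ p, Nat.card (K p) := by
      rw [Nat.card_congr (Equiv.Set.univPi fun p => (K p : Set (O ⧸ J))), Nat.card_pi]
      rfl
    _ = _ := Finset.prod_congr rfl fun p _ => card_map_span_pow hπ (hN _ _)

/-- Modulo π^N with N = ∑ r_ι, an upper bound for all weight exponents, the congruence kernel lies
in the subgroup. The index is thus the quotient of two image orders, the whole group being the case
r = 0. -/
theorem index_wtSubgroup (hI : ∀ t ∈ I, t ≤ n) {π : O} (hπ : Irreducible π) (r : I → ℕ) :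
    (wtSubgroup n fun ι => π ^ r ι).index =
      resCard O ^ ∑ ι : I, r ι * ((ι : ℕ) * (n - (ι : ℕ))) := by
  have hx : ∀ (r : I → ℕ) (ι : I), π ^ r ι ≠ 0 := fun r ι => pow_ne_zero _ hπ.ne_zero
  set N := ∑ ι, r ι with hN
  have hNle : ∀ i j : Fin n, wtExp r i j ≤ N := fun i j =>
    Finset.sum_le_sum_of_subset (Finset.subset_univ _)
  have htop : (wtSubgroup n fun ι : I => π ^ (0 : I → ℕ) ι) = ⊤ := by
    rw [eq_top_iff]
    intro B _
    rw [mem_wtSubgroup (hx 0)]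
    intro i j
    rw [wt_pow, wtExp]
    simp
  have h0 := card_map_wtSubgroup (n := n) (N := N) hπ (0 : I → ℕ) (by intro i j; simp [wtExp])
  have h1 := card_map_wtSubgroup (n := n) (N := N) hπ r hNle
  rw [htop, ← Subgroup.relIndex_ker, Subgroup.relIndex_top_right] at h0
  rw [← Subgroup.relIndex_ker] at h1
  have hker : (reduceHom n I (Ideal.span {π ^ N})).ker ≤ wtSubgroup n fun ι => π ^ r ι := by
    intro B hB
    rw [MonoidHom.mem_ker, ← map_one (reduceHom n I (Ideal.span {π ^ N})),
      reduceHom_eq_iff] at hB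
    rw [mem_wtSubgroup (hx r)]
    intro i j
    have h := hB i j
    rw [Ideal.Quotient.eq, Ideal.mem_span_singleton] at h
    rw [wt_pow]
    have h2 : π ^ wtExp r i j ∣ toMat (1 : LI n I O) i j := by
      rw [← wt_pow]
      exact (mem_wtSubgroup (hx r)).1 (one_mem (wtSubgroup n fun ι => π ^ r ι)) i j
    exact (dvd_sub_left h2).1 ((pow_dvd_pow π (hNle i j)).trans h)
  have h2 := Subgroup.relIndex_mul_index hker
  rw [h0, h1] at h2
  have hq : 0 < resCard O := (one_lt_resCard O).le
  refine Nat.eq_of_mul_eq_mul_left (Finset.prod_pos fun p _ => pow_pos hq (N -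
    wtExp r (p : {p : Fin n × Fin n // Below I p.1 p.2}).1.1 p.1.2)) (h2.trans ?_)
  rw [← sum_wtExp hI, ← Finset.prod_pow_eq_pow_sum, ← Finset.prod_mul_distrib]
  refine Finset.prod_congr rfl fun p _ => ?_
  rw [← pow_add, Nat.sub_add_cancel (hNle _ _)]
  simp [wtExp]

end Index

/-! ### Haar measure and cosets in compact groups -/

section CompactGroup

variable {G : Type*} [Group G] [TopologicalSpace G] [IsTopologicalGroup G] [CompactSpace G]
  [MeasurableSpace G] [BorelSpace G]

/-- A right translate of μ is again left invariant, hence a multiple of μ by uniqueness of Haar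
measure, and total mass 1 fixes the multiple. -/
theorem isMulRightInvariant_of_compactSpace (μ : Measure G) [μ.IsHaarMeasure]
    [IsProbabilityMeasure μ] : μ.IsMulRightInvariant := by
  refine ⟨fun g => ?_⟩
  have : IsProbabilityMeasure (μ.map (· * g)) :=
    Measure.isProbabilityMeasure_map (measurable_mul_const g).aemeasurable
  have h := Measure.isMulInvariant_eq_smul_of_compactSpace (μ.map (· * g)) μ
  have h1 := congrArg (fun ν => ν Set.univ) h
  simp only [measure_univ, Measure.smul_apply, ENNReal.smul_def, smul_eq_mul, mul_one] at h1
  rw [h]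
  ext s _
  rw [Measure.smul_apply, ENNReal.smul_def, ← h1, one_smul]

/-- The measure of a set that is invariant under left multiplication by an open subgroup. -/
theorem measureReal_eq_card_cosets (μ : Measure G) [μ.IsHaarMeasure] [IsProbabilityMeasure μ]
    (H : Subgroup G) (hH : IsOpen (H : Set G)) [H.FiniteIndex] {T : Set G}
    (hT : ∀ h ∈ H, ∀ b ∈ T, h * b ∈ T) :
    IsOpen T ∧ ((invCoset H '' T).ncard : ℝ) = H.index * μ.real T := by
  have : μ.IsMulRightInvariant := isMulRightInvariant_of_compactSpace μ
  have hcos : ∀ B : G, invCoset H ⁻¹' {invCoset H B} = (fun x => x * B⁻¹) ⁻¹' (H : Set G) := by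
    intro B
    ext x
    exact invCoset_eq_iff
  have hopen : ∀ c : G ⧸ H, IsOpen (invCoset H ⁻¹' {c}) := by
    intro c
    obtain ⟨B, rfl⟩ := QuotientGroup.mk_surjective c
    have := hcos B⁻¹
    rw [invCoset, inv_inv] at this
    rw [this]
    exact hH.preimage (continuous_mul_const _)
  have hmeas : ∀ c : G ⧸ H, μ.real (invCoset H ⁻¹' {c}) = (H.index : ℝ)⁻¹ := by
    intro c
    obtain ⟨B, rfl⟩ := QuotientGroup.mk_surjective c
    have h1 := hcos B⁻¹
    rw [invCoset, inv_inv] at h1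
    have h2 := H.index_mul_measure hH.measurableSet μ
    rw [h1, measureReal_def, measure_preimage_mul_right]
    refine eq_inv_of_mul_eq_one_right ?_
    simpa using congrArg ENNReal.toReal h2
  -- By its invariance T is a union of cosets HB. Each is a right translate of H, so right
  -- invariance gives all of them the measure of H, which is 1/index.
  have hTe : T = ⋃ c ∈ invCoset H '' T, invCoset H ⁻¹' {c} := by
    ext x
    simp only [Set.mem_iUnion, Set.mem_preimage, Set.mem_singleton_iff, exists_prop]
    constructor
    · exact fun hx => ⟨_, ⟨x, hx, rfl⟩, rfl⟩
    · rintro ⟨_, ⟨b, hb, rfl⟩, h⟩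
      have := hT _ (invCoset_eq_iff.1 h) b hb
      rwa [inv_mul_cancel_right] at this
  refine ⟨by rw [hTe]; exact isOpen_biUnion fun c _ => hopen c, ?_⟩
  have hfin : (invCoset H '' T).Finite := Set.toFinite _
  have h1 : μ.real T = ∑ c ∈ hfin.toFinset, μ.real (invCoset H ⁻¹' {c}) := by
    conv_lhs => rw [hTe]
    rw [← measureReal_biUnion_finset]
    · simp
    · intro c _ c' _ hne
      exact Disjoint.preimage _ (by simpa using hne)
    · exact fun c _ => (hopen c).measurableSet
  rw [h1, Finset.sum_congr rfl fun c _ => hmeas c, Finset.sum_const, nsmul_eq_mul,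
    Set.ncard_eq_toFinset_card _ hfin, mul_comm, mul_assoc, inv_mul_cancel₀, mul_one]
  exact Nat.cast_ne_zero.2 Subgroup.FiniteIndex.index_ne_zero

end CompactGroup

/-! ### The formula for h_n -/

section CompactDVR

variable {O : Type*} [CommRing O] [IsDomain O] [IsDiscreteValuationRing O]
  [TopologicalSpace O] [IsTopologicalRing O] [CompactSpace O] [T2Space O]

theorem finite_quotient_span {a : O} (ha : a ≠ 0) : Finite (O ⧸ Ideal.span {a}) :=
  IsLocalRing.isOpen_iff_finite_quotient.1
    (IsDedekindDomain.isOpen_of_ne_bot (by simpa using ha))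

variable {n : ℕ} {I : Finset ℕ}

theorem isOpen_wtSubgroup {x : I → O} (hx : ∀ ι, x ι ≠ 0) :
    IsOpen (wtSubgroup n x : Set (LI n I O)) := by
  have : (wtSubgroup n x : Set (LI n I O)) =
      ⋂ i, ⋂ j, (fun B : LI n I O => toMat B i j) ⁻¹' (Ideal.span {wt x i j} : Ideal O) := by
    ext B
    rw [SetLike.mem_coe, mem_wtSubgroup hx]
    simp only [Set.mem_iInter, Set.mem_preimage, SetLike.mem_coe, Ideal.mem_span_singleton]
  rw [this]
  refine isOpen_iInter_of_finite fun i => isOpen_iInter_of_finite fun j => IsOpen.preimage ?_ ?_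
  · have hSL : Continuous fun A : Matrix.SpecialLinearGroup (Fin n) O => A.1 i j :=
      (continuous_apply j).comp ((continuous_apply i).comp continuous_subtype_val)
    exact hSL.comp continuous_subtype_val
  · refine IsDedekindDomain.isOpen_of_ne_bot ?_
    rw [Ne, Ideal.span_singleton_eq_bot]
    exact Finset.prod_ne_zero_iff.2 fun ι _ => hx ι

instance instIsProbabilityMeasureHaarLI : IsProbabilityMeasure (haarLI n I O) :=
  ⟨by rw [haarLI, ← PositiveCompacts.coe_top]; exact Measure.haarMeasure_self⟩

instance instIsHaarMeasureHaarLI : (haarLI n I O).IsHaarMeasure := by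
  rw [haarLI]; infer_instance

variable {π : O} (hπ : Irreducible π) (hI : ∀ t ∈ I, t ≤ n)

include hπ hI

theorem isOpen_setB_inter_fiber (r₀ : ℕ) (r : I → ℕ+)
    (E : LI n I (IsLocalRing.ResidueField O)) :
    IsOpen (setB n π r₀ r ∩ fiber E) ∧
      ((invCoset (wtSubgroup n fun ι => π ^ (r ι : ℕ)) '' (setB n π r₀ r ∩ fiber E)).ncard : ℝ) =
      (resCard O : ℝ) ^ (∑ ι : I, (r ι : ℕ) * ((ι : ℕ) * (n - (ι : ℕ)))) *
        (haarLI n I O).real (setB n π r₀ r ∩ fiber E) := by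
  have h0 : π ^ r₀ ≠ 0 := pow_ne_zero _ hπ.ne_zero
  have hx : ∀ ι : I, π ^ (r ι : ℕ) ≠ 0 := fun ι => pow_ne_zero _ hπ.ne_zero
  have hπm : π ∈ IsLocalRing.maximalIdeal O := (IsLocalRing.mem_maximalIdeal π).2 hπ.not_isUnit
  have hxm : ∀ ι : I, π ^ (r ι : ℕ) ∈ IsLocalRing.maximalIdeal O :=
    fun ι => Ideal.pow_mem_of_mem _ hπm _ (r ι).pos
  have hidx := index_wtSubgroup hI hπ fun ι => (r ι : ℕ)
  have : (wtSubgroup n fun ι => π ^ (r ι : ℕ)).FiniteIndex :=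
    ⟨by rw [hidx]; exact pow_ne_zero _ (one_lt_resCard O).ne_bot⟩
  have := measureReal_eq_card_cosets (haarLI n I O) _ (isOpen_wtSubgroup hx)
    (T := setB n π r₀ r ∩ fiber E) ?_
  · rw [hidx] at this
    exact_mod_cast this
  · rintro h hh b ⟨hb, hb'⟩
    refine ⟨divCond_mul_of_mem h0 hx hh hb, ?_⟩
    rw [mem_fiber_iff] at hb' ⊢
    rw [reduceLI_mul_of_mem hxm hh, hb']

theorem finite_and_hNum_eq (r₀ : ℕ) (r : I → ℕ+) :
    (subalgebrasOfType n π I r₀ r).Finite ∧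
      (hNum n π I r₀ r : ℝ) =
        (resCard O : ℝ) ^ (∑ ι : I, (r ι : ℕ) * ((ι : ℕ) * (n - (ι : ℕ)))) *
          ∑ E : LI n I (IsLocalRing.ResidueField O),
            (tau I E : ℝ) * (haarLI n I O).real (setB n π r₀ r ∩ fiber E) := by
  have : (wtSubgroup n fun ι => π ^ (r ι : ℕ)).FiniteIndex := ⟨by
    rw [index_wtSubgroup hI hπ fun ι => (r ι : ℕ)]; exact pow_ne_zero _ (one_lt_resCard O).ne_bot⟩
  obtain ⟨h1, h2⟩ := subalgebrasOfType_finite_and_hNum_eq (r₀ := r₀) (r := r) hI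
    (fun a ha => finite_quotient_span ha) hπ.ne_zero
    ((IsLocalRing.mem_maximalIdeal π).2 hπ.not_isUnit)
  refine ⟨h1, ?_⟩
  rw [h2, Nat.cast_sum, Finset.mul_sum]
  refine Finset.sum_congr rfl fun E _ => ?_
  rw [Nat.cast_mul, (isOpen_setB_inter_fiber hπ hI r₀ r E).2, mul_left_comm]

end CompactDVR

/-! ### Spheres in a compact discrete valuation ring -/

section Spheres

variable {O : Type*} [CommRing O]

instance instIsProbabilityMeasureHaarO {O : Type*} [CommRing O] [TopologicalSpace O]
    [IsTopologicalRing O] [CompactSpace O] [MeasurableSpace O] [BorelSpace O] : IsProbabilityMeasure (haarO O) :=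
  ⟨by rw [haarO, ← PositiveCompacts.coe_top]; exact Measure.addHaarMeasure_self⟩

/-- The elements of valuation `k`. -/
def sphere (π : O) (k : ℕ) : Set O := {x | Associated x (π ^ k)}

variable [IsDomain O] {π : O} (hπ : Irreducible π)

include hπ

theorem sphere_injective {x : O} {k l : ℕ} (hk : x ∈ sphere π k) (hl : x ∈ sphere π l) :
    k = l := by
  have h : Associated (π ^ k) (π ^ l) := (Associated.symm hk).trans hl
  have h1 := h.dvd
  have h2 := h.symm.dvd
  rw [pow_dvd_pow_iff hπ.ne_zero hπ.not_isUnit] at h1 h2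
  omega

theorem sphere_ne_zero {x : O} {k : ℕ} (hk : x ∈ sphere π k) : x ≠ 0 := by
  rintro rfl
  exact pow_ne_zero k hπ.ne_zero (associated_zero_iff_eq_zero _ |>.1 (Associated.symm hk))

variable [IsDiscreteValuationRing O]

theorem exists_mem_sphere {x : O} (hx : x ≠ 0) : ∃ k, x ∈ sphere π k :=
  IsDiscreteValuationRing.associated_pow_irreducible hx hπ

theorem sphere_subset_maximalIdeal {x : O} {k : ℕ} (hk : x ∈ sphere π k) :
    x ∈ IsLocalRing.maximalIdeal O ↔ 0 < k := by
  have hk' : Associated x (π ^ k) := hk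
  rw [hπ.maximalIdeal_eq, Ideal.mem_span_singleton, hk'.dvd_iff_dvd_right]
  conv_lhs => rw [← pow_one π, ← pow_mul, one_mul, pow_dvd_pow_iff hπ.ne_zero hπ.not_isUnit]
  exact Nat.one_le_iff_ne_zero.trans Nat.pos_iff_ne_zero.symm

theorem dvrAbs_of_mem_sphere {x : O} {k : ℕ} (hk : x ∈ sphere π k) :
    dvrAbs x = ((resCard O : ℝ)⁻¹) ^ k := by
  obtain ⟨u, hu⟩ := Associated.symm hk
  rw [dvrAbs, if_neg (sphere_ne_zero hπ hk),
    IsDiscreteValuationRing.addVal_def x u hπ k (by rw [← hu, mul_comm])]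
  rfl

theorem sphere_eq_sdiff (k : ℕ) :
    sphere π k = (Ideal.span {π ^ k} : Set O) \ (Ideal.span {π ^ (k + 1)} : Ideal O) := by
  ext x
  simp only [Set.mem_sdiff, SetLike.mem_coe, Ideal.mem_span_singleton]
  constructor
  · intro h
    have h' : Associated x (π ^ k) := h
    rw [h'.dvd_iff_dvd_right, h'.dvd_iff_dvd_right,
      pow_dvd_pow_iff hπ.ne_zero hπ.not_isUnit, pow_dvd_pow_iff hπ.ne_zero hπ.not_isUnit]
    omega
  · rintro ⟨h1, h2⟩
    have hx : x ≠ 0 := by rintro rfl; exact h2 (dvd_zero _)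
    obtain ⟨l, hl⟩ := exists_mem_sphere hπ hx
    have hl' : Associated x (π ^ l) := hl
    rw [hl'.dvd_iff_dvd_right, pow_dvd_pow_iff hπ.ne_zero hπ.not_isUnit] at h1 h2
    obtain rfl : k = l := by omega
    exact hl

variable [TopologicalSpace O] [IsTopologicalRing O] [CompactSpace O] [T2Space O]

theorem isOpen_span_pow (k : ℕ) : IsOpen ((Ideal.span {π ^ k} : Ideal O) : Set O) := by
  refine IsDedekindDomain.isOpen_of_ne_bot ?_
  rw [Ne, Ideal.span_singleton_eq_bot]
  exact pow_ne_zero _ hπ.ne_zero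

variable [MeasurableSpace O] [BorelSpace O]

theorem haarO_span_pow (k : ℕ) :
    (haarO O).real ((Ideal.span {π ^ k} : Ideal O) : Set O) = ((resCard O : ℝ)⁻¹) ^ k := by
  have hidx := index_span_pow hπ k
  have : (Ideal.span {π ^ k}).toAddSubgroup.FiniteIndex :=
    ⟨by rw [hidx]; exact pow_ne_zero _ (one_lt_resCard O).ne_bot⟩
  have : (haarO O).IsAddLeftInvariant := by rw [haarO]; infer_instance
  have h := (Ideal.span {π ^ k}).toAddSubgroup.index_mul_measure
    (isOpen_span_pow hπ k).measurableSet (haarO O)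
  rw [hidx] at h
  rw [inv_pow]
  refine eq_inv_of_mul_eq_one_right ?_
  simpa [measureReal_def] using congrArg ENNReal.toReal h

theorem measurableSet_sphere (k : ℕ) : MeasurableSet (sphere π k) := by
  rw [sphere_eq_sdiff hπ]
  exact (isOpen_span_pow hπ k).measurableSet.diff (isOpen_span_pow hπ _).measurableSet

theorem haarO_sphere (k : ℕ) :
    (haarO O).real (sphere π k) = ((resCard O : ℝ)⁻¹) ^ k * (1 - (resCard O : ℝ)⁻¹) := by
  rw [sphere_eq_sdiff hπ, measureReal_sdiff _ (isOpen_span_pow hπ _).measurableSet,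
    haarO_span_pow hπ, haarO_span_pow hπ]
  · ring
  · exact Ideal.span_singleton_le_span_singleton.2 (pow_dvd_pow π (Nat.le_succ k))

/-- The point 0 lies in ideals of measure q^(-k) for all k, and translation moves it to any other
point. -/
theorem nullSingletonClass_haarO : NullSingletonClass (haarO O) := by
  have : (haarO O).IsAddLeftInvariant := by rw [haarO]; infer_instance
  have h0 : (haarO O).real {0} = 0 := by
    refine le_antisymm ?_ measureReal_nonneg
    have hlim : Filter.Tendsto (fun k : ℕ => ((resCard O : ℝ)⁻¹) ^ k) Filter.atTop (nhds 0) :=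
      tendsto_pow_atTop_nhds_zero_of_lt_one (by positivity)
        (inv_lt_one_of_one_lt₀ (by exact_mod_cast one_lt_resCard O))
    refine ge_of_tendsto' hlim fun k => ?_
    rw [← haarO_span_pow hπ]
    exact measureReal_mono (by simp)
  refine ⟨fun x => ?_⟩
  have h1 : ({x} : Set O) = (fun y => -x + y) ⁻¹' {0} := by
    ext y
    simp only [Set.mem_singleton_iff, Set.mem_preimage]
    rw [neg_add_eq_zero, eq_comm]
  rw [h1, measure_preimage_add]
  rwa [measureReal_eq_zero_iff] at h0

end Spheres

/-! ### Integration of functions that are constant on the parts of a partition -/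

section Partition

variable {X ι : Type*} [MeasurableSpace X] [Countable ι] {μ : Measure X}
  {s : ι → Set X} {f : X → ℂ} {c : ι → ℂ}

theorem integrableOn_iUnion_const_iff [IsFiniteMeasure μ] (hs : ∀ i, MeasurableSet (s i))
    (hd : Pairwise (Function.onFun Disjoint s)) (hf : ∀ i, ∀ x ∈ s i, f x = c i) :
    IntegrableOn f (⋃ i, s i) μ ↔ Summable fun i => ‖(μ.real (s i) : ℂ) * c i‖ := by
  have hn : ∀ i, ∫ x in s i, ‖f x‖ ∂μ = ‖(μ.real (s i) : ℂ) * c i‖ := by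
    intro i
    rw [setIntegral_congr_fun (hs i) fun x hx => by rw [hf i x hx], setIntegral_const,
      norm_mul, Complex.norm_real, Real.norm_of_nonneg measureReal_nonneg, smul_eq_mul]
  simp only [← hn]
  constructor
  · exact fun h => (hasSum_integral_iUnion hs hd h.norm).summable
  · refine integrableOn_iUnion_of_summable_integral_norm fun i => ?_
    exact (integrableOn_congr_fun (hf i) (hs i)).2 (integrableOn_const (measure_ne_top μ _))

theorem integral_iUnion_const (hs : ∀ i, MeasurableSet (s i))
    (hd : Pairwise (Function.onFun Disjoint s)) (hf : ∀ i, ∀ x ∈ s i, f x = c i)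
    (h : IntegrableOn f (⋃ i, s i) μ) :
    ∫ x in ⋃ i, s i, f x ∂μ = ∑' i, (μ.real (s i) : ℂ) * c i := by
  rw [integral_iUnion hs hd h]
  congr 1
  ext i
  rw [setIntegral_congr_fun (hs i) (hf i), setIntegral_const, Complex.real_smul]

end Partition

/-! ### The integral over `ℳ'_I` -/

instance instIsFiniteMeasureHaarProd {n : ℕ} {I : Finset ℕ} {O : Type*} [CommRing O]
    [IsDomain O] [IsDiscreteValuationRing O] [TopologicalSpace O] [IsTopologicalRing O]
    [CompactSpace O] [T2Space O] [MeasurableSpace O] [BorelSpace O] :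
    IsFiniteMeasure (haarProd n I O) := by
  rw [haarProd]; infer_instance

section Integral

variable {n : ℕ} {I : Finset ℕ} {O : Type*} [CommRing O]

theorem wt_associated {x y : I → O} (h : ∀ ι, Associated (x ι) (y ι)) (i j : Fin n) :
    Associated (wt x i j) (wt y i j) := Associated.prod _ _ _ fun ι _ => h ι

theorem dg_associated {x y : I → O} (h : ∀ ι, Associated (x ι) (y ι)) (i : Fin n) :
    Associated (dg x i) (dg y i) := Associated.prod _ _ _ fun ι _ => h ι

/-- Unit factors do not affect divisibility, so only the valuations of x₀ and of the x_ι matter and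
the condition is constant on cells. -/
theorem divCond_iff_of_associated {x₀ y₀ : O} {x y : I → O} (h0 : Associated x₀ y₀)
    (h : ∀ ι, Associated (x ι) (y ι)) (B : LI n I O) : DivCond x₀ x B ↔ DivCond y₀ y B := by
  refine forall_congr' fun j => forall_congr' fun i => forall_congr' fun i' =>
    imp_congr_right fun _ => imp_congr_right fun _ => ?_
  have h1 := ((h0.mul_mul (dg_associated h i')).mul_right
    (∑ k ∈ Finset.Iic i, toMat B i k * toMat B i' k * toMat B⁻¹ k j))
  exact ((wt_associated h i j).dvd_iff_dvd_left).trans h1.dvd_iff_dvd_right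

variable [IsDomain O] [IsDiscreteValuationRing O] {π : O}

/-- The part of `ℳ'_I` above `E` with prescribed valuations of `x₀` and of the `x_ι`. -/
def cell (π : O) (E : LI n I (IsLocalRing.ResidueField O)) (p : ℕ × (I → ℕ+)) :
    Set (O × (I → O) × LI n I O) :=
  sphere π p.1 ×ˢ ((Set.univ.pi fun ι => sphere π (p.2 ι : ℕ)) ×ˢ (setB n π p.1 p.2 ∩ fiber E))

theorem mem_cell {E : LI n I (IsLocalRing.ResidueField O)} {p : ℕ × (I → ℕ+)}
    {y : O × (I → O) × LI n I O} : y ∈ cell π E p ↔ y.1 ∈ sphere π p.1 ∧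
      (∀ ι, y.2.1 ι ∈ sphere π (p.2 ι : ℕ)) ∧ y.2.2 ∈ setB n π p.1 p.2 ∧ y.2.2 ∈ fiber E := by
  simp [cell, Set.mem_prod]

variable (hπ : Irreducible π)

include hπ

theorem iUnion_cell (E : LI n I (IsLocalRing.ResidueField O)) :
    ⋃ p, cell π E p = {p | p ∈ setM n I O ∧ p.2.2 ∈ fiber E} \
      {p | p.1 = 0 ∨ ∃ ι, p.2.1 ι = 0} := by
  ext y
  simp only [Set.mem_iUnion, mem_cell, Set.mem_sdiff, Set.mem_ofPred_eq, not_or, not_exists]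
  constructor
  · rintro ⟨p, h0, h1, h2, h3⟩
    exact ⟨⟨⟨fun ι => (sphere_subset_maximalIdeal hπ (h1 ι)).2 (p.2 ι).pos,
      (divCond_iff_of_associated h0 h1 _).2 h2⟩, h3⟩, sphere_ne_zero hπ h0,
      fun ι => sphere_ne_zero hπ (h1 ι)⟩
  · rintro ⟨⟨⟨h1, h2⟩, h3⟩, h4, h5⟩
    obtain ⟨r₀, hr₀⟩ := exists_mem_sphere hπ h4
    choose r hr using fun ι => exists_mem_sphere hπ (h5 ι)
    refine ⟨(r₀, fun ι => ⟨r ι, (sphere_subset_maximalIdeal hπ (hr ι)).1 (h1 ι)⟩), hr₀, hr,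
      (divCond_iff_of_associated hr₀ hr _).1 h2, h3⟩

theorem pairwise_disjoint_cell (E : LI n I (IsLocalRing.ResidueField O)) :
    Pairwise (Function.onFun Disjoint (cell π E)) := by
  intro p p' hne
  refine Set.disjoint_left.2 fun y hy hy' => hne ?_
  rw [mem_cell] at hy hy'
  exact Prod.ext (sphere_injective hπ hy.1 hy'.1)
    (funext fun ι => PNat.eq (sphere_injective hπ (hy.2.1 ι) (hy'.2.1 ι)))

/-- The value of the integrand on a cell. -/
theorem xiIntegrand_of_mem_cell {E : LI n I (IsLocalRing.ResidueField O)} (s₀ : ℂ) (s : I → ℂ)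
    (p : ℕ × (I → ℕ+)) : ∀ y ∈ cell π E p, xiIntegrand n I s₀ s y =
      ((((resCard O : ℝ)⁻¹) ^ p.1 : ℝ) : ℂ) ^ (s₀ * n - 1) *
        ∏ ι : I, ((((resCard O : ℝ)⁻¹) ^ (p.2 ι : ℕ) : ℝ) : ℂ) ^
          (((ι : ℕ) : ℂ) * (s ι - ((n : ℂ) - ((ι : ℕ) : ℂ))) - 1) := by
  intro y hy
  rw [mem_cell] at hy
  rw [xiIntegrand, dvrAbs_of_mem_sphere hπ hy.1]
  congr 1
  exact Finset.prod_congr rfl fun ι _ => by rw [dvrAbs_of_mem_sphere hπ (hy.2.1 ι)]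

variable [TopologicalSpace O] [IsTopologicalRing O] [CompactSpace O] [T2Space O]
  [MeasurableSpace O] [BorelSpace O]

/-- Points with a vanishing coordinate belong to no cell; since they form a null set, the values of
the integrand there are irrelevant. -/
theorem haarProd_exists_eq_zero :
    haarProd n I O {p | p.1 = 0 ∨ ∃ ι, p.2.1 ι = 0} = 0 := by
  have := nullSingletonClass_haarO hπ
  have hset : ({p | p.1 = 0 ∨ ∃ ι, p.2.1 ι = 0} : Set (O × (I → O) × LI n I O)) =
      (({0} : Set O) ×ˢ Set.univ) ∪
        ⋃ ι : I, (Set.univ : Set O) ×ˢ ({x : I → O | x ι = 0} ×ˢ Set.univ) := by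
    ext p
    simp [Set.mem_prod]
  rw [hset, measure_union_null_iff]
  refine ⟨by rw [haarProd, Measure.prod_prod, measure_singleton, zero_mul], ?_⟩
  refine measure_iUnion_null fun ι => ?_
  rw [haarProd, Measure.prod_prod, Measure.prod_prod, Measure.pi_hyperplane, zero_mul, mul_zero]

theorem setM_inter_fiber_ae_eq (E : LI n I (IsLocalRing.ResidueField O)) :
    {p | p ∈ setM n I O ∧ p.2.2 ∈ fiber E} =ᵐ[haarProd n I O] ⋃ p, cell π E p := by
  rw [iUnion_cell hπ]
  exact (sdiff_null_ae_eq_self (haarProd_exists_eq_zero hπ)).symm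

theorem haarProd_cell (E : LI n I (IsLocalRing.ResidueField O)) (p : ℕ × (I → ℕ+)) :
    (haarProd n I O).real (cell π E p) =
      ((resCard O : ℝ)⁻¹) ^ p.1 * (1 - (resCard O : ℝ)⁻¹) *
        ((∏ ι, ((resCard O : ℝ)⁻¹) ^ (p.2 ι : ℕ) * (1 - (resCard O : ℝ)⁻¹)) *
          (haarLI n I O).real (setB n π p.1 p.2 ∩ fiber E)) := by
  rw [cell, haarProd, measureReal_prod_prod, measureReal_prod_prod, haarO_sphere hπ,
    measureReal_def, Measure.pi_pi, ENNReal.toReal_prod]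
  congr 2
  exact Finset.prod_congr rfl fun ι _ => haarO_sphere hπ _

theorem measurableSet_cell (hI : ∀ t ∈ I, t ≤ n) (E : LI n I (IsLocalRing.ResidueField O))
    (p : ℕ × (I → ℕ+)) : MeasurableSet (cell π E p) :=
  (measurableSet_sphere hπ _).prod
    ((MeasurableSet.univ_pi fun _ => measurableSet_sphere hπ _).prod
      (isOpen_setB_inter_fiber hπ hI _ _ E).1.measurableSet)

end Integral

/-! ### Comparison of the series with the integrals -/

section Xi

variable {n : ℕ} {I : Finset ℕ}

/-- The base is a positive real, so its logarithm is real and no choice of branch interferes. -/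
theorem inv_pow_cpow {q : ℕ} (hq : 1 < q) (k : ℕ) (z : ℂ) :
    ((((q : ℝ)⁻¹) ^ k : ℝ) : ℂ) ^ z = (q : ℂ) ^ (-((k : ℂ) * z)) := by
  have hq0 : (q : ℂ) ≠ 0 := by exact_mod_cast (by omega : q ≠ 0)
  have hpos : (0 : ℝ) < ((q : ℝ)⁻¹) ^ k := by positivity
  rw [Complex.cpow_def_of_ne_zero (by exact_mod_cast hpos.ne'), Complex.cpow_def_of_ne_zero hq0,
    ← Complex.ofReal_log hpos.le, Real.log_pow, Real.log_inv, ← Complex.ofReal_natCast q,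
    ← Complex.ofReal_log (Nat.cast_nonneg q)]
  push_cast
  ring_nf

theorem prod_cpow_eq_cpow_sum {ι : Type*} {q : ℂ} (hq : q ≠ 0) (t : Finset ι) (f : ι → ℂ) :
    ∏ i ∈ t, q ^ f i = q ^ ∑ i ∈ t, f i := by
  simp only [Complex.cpow_def_of_ne_zero hq, Finset.mul_sum, Complex.exp_sum]

theorem one_sub_inv_resCard_pow_ne_zero (O : Type*) [CommRing O] [IsLocalRing O]
    [Finite (IsLocalRing.ResidueField O)] (k : ℕ) : (1 - (resCard O : ℂ)⁻¹) ^ k ≠ 0 := by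
  refine pow_ne_zero _ (sub_ne_zero.2 fun h => ?_)
  have h1 : 1 < resCard O := Finite.one_lt_card
  have h2 : resCard O = 1 := by exact_mod_cast inv_eq_one.1 h.symm
  exact h1.ne' h2

/-- The coefficient of the measures in the term of index `p` of `Ξ_{n,I}`. -/
noncomputable def xiCoeff (n : ℕ) {I : Finset ℕ} (q : ℕ) (s₀ : ℂ) (s : I → ℂ)
    (p : ℕ × (I → ℕ+)) : ℂ :=
  (q : ℂ) ^ (-(s₀ * n * p.1) - ∑ ι : I, ((p.2 ι : ℕ) : ℂ) * ((ι : ℕ) : ℂ) * s ι) *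
    (q : ℂ) ^ (∑ ι : I, (p.2 ι : ℕ) * ((ι : ℕ) * (n - (ι : ℕ))))

/-- The radius q^(-k) in each sphere measure absorbs the -1 in the matching exponent of the
integrand, the shifts by n - ι produce the power of q coming from the index, and the #I + 1 spheres
contribute the factors 1 - q⁻¹. -/
theorem cell_const_eq {q : ℕ} (hq : 1 < q) (hI : ∀ t ∈ I, t ≤ n) (s₀ : ℂ) (s : I → ℂ)
    (p : ℕ × (I → ℕ+)) :
    (((q : ℝ)⁻¹ ^ p.1 * (1 - (q : ℝ)⁻¹) *
        (∏ ι, (q : ℝ)⁻¹ ^ (p.2 ι : ℕ) * (1 - (q : ℝ)⁻¹)) : ℝ) : ℂ) *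
      (((((q : ℝ)⁻¹) ^ p.1 : ℝ) : ℂ) ^ (s₀ * n - 1) *
        ∏ ι : I, ((((q : ℝ)⁻¹) ^ (p.2 ι : ℕ) : ℝ) : ℂ) ^
          (((ι : ℕ) : ℂ) * (s ι - ((n : ℂ) - ((ι : ℕ) : ℂ))) - 1)) =
      (1 - (q : ℂ)⁻¹) ^ (I.card + 1) * xiCoeff n q s₀ s p := by
  have hq0 : (q : ℂ) ≠ 0 := by exact_mod_cast (by omega : q ≠ 0)
  have hone : ∀ (k : ℕ) (z : ℂ), ((((q : ℝ)⁻¹) ^ k : ℝ) : ℂ) * ((((q : ℝ)⁻¹) ^ k : ℝ) : ℂ) ^ (z - 1)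
      = (q : ℂ) ^ (-((k : ℂ) * z)) := by
    intro k z
    have h1 := inv_pow_cpow hq k 1
    rw [Complex.cpow_one] at h1
    rw [inv_pow_cpow hq, h1, ← Complex.cpow_add _ _ hq0]
    ring_nf
  have hnat : (q : ℂ) ^ (∑ ι : I, (p.2 ι : ℕ) * ((ι : ℕ) * (n - (ι : ℕ)))) =
      (q : ℂ) ^ (∑ ι : I, ((p.2 ι : ℕ) : ℂ) * (((ι : ℕ) : ℂ) * ((n : ℂ) - ((ι : ℕ) : ℂ)))) := by
    rw [← Complex.cpow_natCast]
    congr 1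
    rw [Nat.cast_sum]
    refine Finset.sum_congr rfl fun ι _ => ?_
    rw [Nat.cast_mul, Nat.cast_mul, Nat.cast_sub (hI ι ι.2)]
  have hlhs : (((q : ℝ)⁻¹ ^ p.1 * (1 - (q : ℝ)⁻¹) *
        (∏ ι, (q : ℝ)⁻¹ ^ (p.2 ι : ℕ) * (1 - (q : ℝ)⁻¹)) : ℝ) : ℂ) =
      (1 - (q : ℂ)⁻¹) ^ (I.card + 1) * ((((q : ℝ)⁻¹) ^ p.1 : ℝ) : ℂ) *
        ∏ ι : I, ((((q : ℝ)⁻¹) ^ (p.2 ι : ℕ) : ℝ) : ℂ) := by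
    rw [Finset.prod_mul_distrib, Finset.prod_const, Finset.card_univ, Fintype.card_coe]
    push_cast
    ring
  rw [hlhs]
  calc _ = (1 - (q : ℂ)⁻¹) ^ (I.card + 1) *
        (((((q : ℝ)⁻¹) ^ p.1 : ℝ) : ℂ) * ((((q : ℝ)⁻¹) ^ p.1 : ℝ) : ℂ) ^ (s₀ * n - 1)) *
        ∏ ι : I, (((((q : ℝ)⁻¹) ^ (p.2 ι : ℕ) : ℝ) : ℂ) * ((((q : ℝ)⁻¹) ^ (p.2 ι : ℕ) : ℝ) : ℂ) ^
          (((ι : ℕ) : ℂ) * (s ι - ((n : ℂ) - ((ι : ℕ) : ℂ))) - 1)) := by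
        rw [Finset.prod_mul_distrib]; ring
    _ = _ := by
        simp only [hone]
        rw [prod_cpow_eq_cpow_sum hq0, mul_assoc, ← Complex.cpow_add _ _ hq0, xiCoeff, hnat,
          ← Complex.cpow_add _ _ hq0]
        congr 2
        rw [sub_eq_add_neg, add_assoc, ← Finset.sum_neg_distrib, ← Finset.sum_add_distrib]
        congr 1
        · ring
        · exact Finset.sum_congr rfl fun ι _ => by ring

variable {O : Type*} [CommRing O] [IsDomain O] [IsDiscreteValuationRing O]
  [TopologicalSpace O] [IsTopologicalRing O] [CompactSpace O] [T2Space O] {π : O} (hπ : Irreducible π) (hI : ∀ t ∈ I, t ≤ n)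

include hπ hI

theorem xiTerm_eq (s₀ : ℂ) (s : I → ℂ) (p : ℕ × (I → ℕ+)) :
    xiTerm n I π s₀ s p = ∑ E : LI n I (IsLocalRing.ResidueField O), (tau I E : ℂ) *
      (xiCoeff n (resCard O) s₀ s p * ((haarLI n I O).real (setB n π p.1 p.2 ∩ fiber E) : ℂ)) := by
  have h := congrArg (fun x : ℝ => (x : ℂ)) (finite_and_hNum_eq hπ hI p.1 p.2).2
  simp only [Complex.ofReal_natCast] at h
  rw [xiTerm, h, xiCoeff]
  push_cast
  rw [← mul_assoc, Finset.mul_sum]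
  exact Finset.sum_congr rfl fun E _ => by ring

/-- All summands over E in one term share the complex factor `xiCoeff` and otherwise have
nonnegative real factors. Each is therefore bounded in norm by the whole term, and τ ≥ 1 removes the
multiplicity. -/
theorem summable_xiTerm_iff (s₀ : ℂ) (s : I → ℂ) :
    Summable (xiTerm n I π s₀ s) ↔ ∀ E : LI n I (IsLocalRing.ResidueField O),
      Summable fun p => xiCoeff n (resCard O) s₀ s p *
        ((haarLI n I O).real (setB n π p.1 p.2 ∩ fiber E) : ℂ) := by
  constructor
  · intro h E
    refine Summable.of_norm_bounded h.norm fun p => ?_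
    rw [xiTerm_eq hπ hI]
    have he : ∀ E : LI n I (IsLocalRing.ResidueField O), (tau I E : ℂ) *
        (xiCoeff n (resCard O) s₀ s p *
          ((haarLI n I O).real (setB n π p.1 p.2 ∩ fiber E) : ℂ)) =
        xiCoeff n (resCard O) s₀ s p *
          (((tau I E : ℝ) * (haarLI n I O).real (setB n π p.1 p.2 ∩ fiber E) : ℝ) : ℂ) := by
      intro E; push_cast; ring
    rw [Finset.sum_congr rfl fun E _ => he E, ← Finset.mul_sum, norm_mul, norm_mul,
      ← Complex.ofReal_sum, Complex.norm_real, Complex.norm_real,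
      Real.norm_of_nonneg measureReal_nonneg, Real.norm_of_nonneg (by positivity)]
    refine mul_le_mul_of_nonneg_left ?_ (norm_nonneg _)
    refine le_trans ?_ (Finset.single_le_sum (f := fun E : LI n I (IsLocalRing.ResidueField O) =>
      (tau I E : ℝ) * (haarLI n I O).real (setB n π p.1 p.2 ∩ fiber E))
      (fun E _ => by positivity) (Finset.mem_univ E))
    exact le_mul_of_one_le_left measureReal_nonneg (by exact_mod_cast tau_pos I E)
  · intro h
    simp only [funext (xiTerm_eq hπ hI s₀ s)]
    exact summable_sum fun E _ => (h E).mul_left _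

variable [MeasurableSpace O] [BorelSpace O]

theorem haarProd_cell_mul (E : LI n I (IsLocalRing.ResidueField O)) (s₀ : ℂ) (s : I → ℂ)
    (p : ℕ × (I → ℕ+)) :
    ((haarProd n I O).real (cell π E p) : ℂ) *
      (((((resCard O : ℝ)⁻¹) ^ p.1 : ℝ) : ℂ) ^ (s₀ * n - 1) *
        ∏ ι : I, ((((resCard O : ℝ)⁻¹) ^ (p.2 ι : ℕ) : ℝ) : ℂ) ^
          (((ι : ℕ) : ℂ) * (s ι - ((n : ℂ) - ((ι : ℕ) : ℂ))) - 1)) =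
      (1 - (resCard O : ℂ)⁻¹) ^ (I.card + 1) * (xiCoeff n (resCard O) s₀ s p *
        ((haarLI n I O).real (setB n π p.1 p.2 ∩ fiber E) : ℂ)) := by
  rw [haarProd_cell hπ, ← mul_assoc ((resCard O : ℝ)⁻¹ ^ p.1 * _), Complex.ofReal_mul,
    mul_right_comm,
    cell_const_eq (one_lt_resCard O) hI, mul_assoc]

theorem integrableOn_iff_summable (E : LI n I (IsLocalRing.ResidueField O)) (s₀ : ℂ) (s : I → ℂ) :
    IntegrableOn (xiIntegrand n I s₀ s) {p | p ∈ setM n I O ∧ p.2.2 ∈ fiber E} (haarProd n I O) ↔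
      Summable fun p => xiCoeff n (resCard O) s₀ s p *
        ((haarLI n I O).real (setB n π p.1 p.2 ∩ fiber E) : ℂ) := by
  rw [integrableOn_congr_set_ae (setM_inter_fiber_ae_eq hπ E),
    integrableOn_iUnion_const_iff (measurableSet_cell hπ hI E) (pairwise_disjoint_cell hπ E)
      (xiIntegrand_of_mem_cell hπ s₀ s)]
  simp only [haarProd_cell_mul hπ hI, summable_norm_iff]
  exact summable_mul_left_iff (one_sub_inv_resCard_pow_ne_zero O _)

theorem setIntegral_eq_tsum (E : LI n I (IsLocalRing.ResidueField O)) (s₀ : ℂ) (s : I → ℂ)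
    (h : IntegrableOn (xiIntegrand n I s₀ s) {p | p ∈ setM n I O ∧ p.2.2 ∈ fiber E}
      (haarProd n I O)) :
    ∫ p in {p | p ∈ setM n I O ∧ p.2.2 ∈ fiber E}, xiIntegrand n I s₀ s p ∂(haarProd n I O) =
      (1 - (resCard O : ℂ)⁻¹) ^ (I.card + 1) * ∑' p, xiCoeff n (resCard O) s₀ s p *
        ((haarLI n I O).real (setB n π p.1 p.2 ∩ fiber E) : ℂ) := by
  rw [setIntegral_congr_set (setM_inter_fiber_ae_eq hπ E),
    integral_iUnion_const (measurableSet_cell hπ hI E) (pairwise_disjoint_cell hπ E)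
      (xiIntegrand_of_mem_cell hπ s₀ s)
      ((integrableOn_congr_set_ae (setM_inter_fiber_ae_eq hπ E)).1 h), ← tsum_mul_left]
  simp only [haarProd_cell_mul hπ hI]

end Xi

end OSubalg

open OSubalg MeasureTheory in
theorem mainTheorem7 {O : Type*} [CommRing O] [IsDomain O] [IsDiscreteValuationRing O]
    [TopologicalSpace O] [IsTopologicalRing O] [CompactSpace O] [T2Space O]
    [MeasurableSpace O] [BorelSpace O] (π : O) (hπ : Irreducible π)
    (n : ℕ) (I : Finset ℕ) (hI : I.Nonempty) (hIn : I ⊆ Finset.Icc 1 (n - 1)) :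
    (∀ (r₀ : ℕ) (r : I → ℕ+),
      (subalgebrasOfType n π I r₀ r).Finite ∧
      (hNum n π I r₀ r : ℝ) =
        (resCard O : ℝ) ^ (∑ ι : I, (r ι : ℕ) * ((ι : ℕ) * (n - (ι : ℕ)))) *
          ∑ E : LI n I (IsLocalRing.ResidueField O),
            (tau I E : ℝ) * (haarLI n I O).real (setB n π r₀ r ∩ fiber E)) ∧
    (∀ (s₀ : ℂ) (s : I → ℂ),
      (Summable (xiTerm n I π s₀ s) ↔
        ∀ E : LI n I (IsLocalRing.ResidueField O),
          IntegrableOn (xiIntegrand n I s₀ s)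
            {p | p ∈ setM n I O ∧ p.2.2 ∈ fiber E} (haarProd n I O)) ∧
      (Summable (xiTerm n I π s₀ s) →
        Xi n I π s₀ s =
          1 / (1 - (resCard O : ℂ)⁻¹) ^ (I.card + 1) *
            ∑ E : LI n I (IsLocalRing.ResidueField O),
              (tau I E : ℂ) *
                ∫ p in {p | p ∈ setM n I O ∧ p.2.2 ∈ fiber E},
                  xiIntegrand n I s₀ s p ∂(haarProd n I O))) := by
  have hIn' : ∀ t ∈ I, t ≤ n := fun t ht => by
    have := Finset.mem_Icc.1 (hIn ht)
    omega
  refine ⟨finite_and_hNum_eq hπ hIn', fun s₀ s => ⟨?_, fun h => ?_⟩⟩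
  · rw [summable_xiTerm_iff hπ hIn']
    exact forall_congr' fun E => (integrableOn_iff_summable hπ hIn' E s₀ s).symm
  · have hE := (summable_xiTerm_iff hπ hIn' s₀ s).1 h
    have hint := fun E => setIntegral_eq_tsum hπ hIn' E s₀ s
      ((integrableOn_iff_summable hπ hIn' E s₀ s).2 (hE E))
    -- Summability for each E allows the finite sum over E to be exchanged with the series.
    rw [Xi, tsum_congr (xiTerm_eq hπ hIn' s₀ s),
      Summable.tsum_finsetSum fun E _ => (hE E).mul_left _, Finset.mul_sum]
    refine Finset.sum_congr rfl fun E _ => ?_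
    rw [hint E, tsum_mul_left, one_div, mul_left_comm,
      inv_mul_cancel_left₀ (one_sub_inv_resCard_pow_ne_zero O _)]
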